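/- Consider circuits over the gate set $\{CCX, CX, X\}$ (Toffoli, CNOT, NOT). A circuit is a finite sequence of layers, each consisting of gates acting on pairwise disjoint sets of qubits; its depth is the number of layers and its gate count is the total number of gates. A circuit on $m+1$ qubits implements an operator $U$ on $m$ qubits using one dirty ancilla qubit if it maps $|\varphi\rangle\otimes|\psi\rangle$ to $U|\varphi\rangle\otimes|\psi\rangle$ for all register states $|\varphi\rangle$ and all states $|\psi\rangle$ of the ancilla. Let $\mathrm{INC}_n$ be the $n$-bit increment operator $|x\rangle\mapsto|(x+1)\bmod 2^n\rangle$ (the first qubit is the least significant bit), let $\mathrm{DEC}_n=\mathrm{INC}_n^{-1}$, i.e. $|x\rangle\mapsto|(x-1)\bmod 2^n\rangle$, and let $C^k\mathrm{INC}_n$ be the $k$-controlled $n$-bit increment operator on $k+n$ qubits, which applies $\mathrm{INC}_n$ to the last $n$ qubits when the first $k$ qubits are all $1$ and is the identity on the other basis states. (i) For all $k,n\ge 0$, $C^k\mathrm{INC}_n=(\mathrm{DEC}_k\otimes I)\,\mathrm{INC}_{k+n}$: a $(k+n)$-bit increment followed by a $k$-bit decrement of the first $k$ qubits. (ii) $C^k\mathrm{INC}_n$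 can be implemented over $\{CCX,CX,X\}$ with $\Theta(k+n)$ gates and, simultaneously, $\Theta(\log(kn))$ depth, using one dirty ancilla qubit. Precisely, there are absolute constants $c,C>0$ such that for all positive integers $k,n$ with $kn\ge 2$: - some circuit implements $C^k\mathrm{INC}_n$ using one dirty ancilla qubit with at most $C(k+n)$ gates and depth at most $C\log(kn)$; it can be taken to be the concatenation of a circuit implementing $\mathrm{INC}_{k+n}$ and a circuit implementing $\mathrm{DEC}_k\otimes I$, each on the same $k+n+1$ qubits and using the same dirty ancilla qubit; - every circuit over $\{CCX,CX,X\}$ that implements $C^k\mathrm{INC}_n$ using one dirty ancilla qubit has at least $c(k+n)$ gates and depth at least $c\log(kn)$. -/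

import Mathlib

/-- The computational basis of a system of qubits with wires `W`: bit strings `x ∈ {0,1}^W`. -/
abbrev Bits (W : Type) : Type := W → Bool

/-- State vectors of a system of qubits with wires `W`, by their amplitudes in the
computational basis. -/
abbrev QState (W : Type) : Type := Bits W → ℂ

/-- The basis state `|x⟩`. -/
def ket {W : Type} [Fintype W] [DecidableEq W] (x : Bits W) : QState W :=
  fun y => if x = y then 1 else 0

/-- The linear operator determined by `|x⟩ ↦ |f x⟩` on basis states. -/
def basisOp {W : Type} [Fintype W] [DecidableEq W] (f : Bits W → Bits W) :
    QState W →ₗ[ℂ] QState W where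
  toFun φ := fun y => ∑ x : Bits W, if f x = y then φ x else 0
  map_add' φ ψ := by
    funext y
    simp only [Pi.add_apply, ← Finset.sum_add_distrib]
    refine Finset.sum_congr rfl fun x _ => ?_
    split_ifs <;> simp
  map_smul' c φ := by
    funext y
    simp only [Pi.smul_apply, smul_eq_mul, RingHom.id_apply, Finset.mul_sum]
    refine Finset.sum_congr rfl fun x _ => ?_
    split_ifs <;> simp

theorem basisOp_ket {W : Type} [Fintype W] [DecidableEq W] (f : Bits W → Bits W) (x : Bits W) :
    basisOp f (ket x) = ket (f x) := by
  funext y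
  simp only [basisOp, ket, LinearMap.coe_mk, AddHom.coe_mk]
  rw [Finset.sum_eq_single x]
  · simp
  · intro b _ hb
    simp [Ne.symm hb]
  · simp

/-- The product state `φ ⊗ ψ` of two systems. -/
def tensorState {R A : Type} (φ : QState R) (ψ : QState A) : QState (R ⊕ A) :=
  fun z => φ (fun r => z (Sum.inl r)) * ψ (fun a => z (Sum.inr a))

/-- A gate of the set `{CCX, CX, X}` placed on pairwise distinct wires of `W`
(controls first, target last). -/
inductive Gate (W : Type) : Type
  | X (t : W) : Gate W
  | CX (c t : W) (h : c ≠ t) : Gate W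
  | CCX (c₁ c₂ t : W) (h₁₂ : c₁ ≠ c₂) (h₁ : c₁ ≠ t) (h₂ : c₂ ≠ t) : Gate W

namespace Gate

/-- The wires on which a gate acts. -/
def support {W : Type} [DecidableEq W] : Gate W → Finset W
  | X t => {t}
  | CX c t _ => {c, t}
  | CCX c₁ c₂ t _ _ _ => {c₁, c₂, t}

/-- Action on basis states: the target bit is flipped iff all control bits are `1`. -/
def act {W : Type} [DecidableEq W] : Gate W → Bits W → Bits W
  | X t, x => Function.update x t (!(x t))
  | CX c t _, x => Function.update x t (xor (x t) (x c))
  | CCX c₁ c₂ t _ _ _, x => Function.update x t (xor (x t) (x c₁ && x c₂))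

/-- The operator of a gate on the state space. -/
def op {W : Type} [Fintype W] [DecidableEq W] (g : Gate W) : QState W →ₗ[ℂ] QState W :=
  basisOp g.act

end Gate

/-- A circuit layer: gates acting on pairwise disjoint sets of wires, hence executable
simultaneously. -/
structure Layer (W : Type) [DecidableEq W] : Type where
  gates : List (Gate W)
  disjoint : gates.Pairwise fun g h => Disjoint g.support h.support

/-- A circuit over `{CCX, CX, X}`: its layers, in the order in which they are executed. -/
abbrev Circuit (W : Type) [DecidableEq W] : Type := List (Layer W)

namespace Circuit

/-- All gates of a circuit, in the order of execution. -/
def allGates {W : Type} [DecidableEq W] (Q : Circuit W) : List (Gate W) :=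
  Q.flatMap Layer.gates

def gateCount {W : Type} [DecidableEq W] (Q : Circuit W) : ℕ := Q.allGates.length

/-- The circuit depth is the number of layers. -/
def depth {W : Type} [DecidableEq W] (Q : Circuit W) : ℕ := List.length Q

/-- The operator of a circuit: the gates are applied one after the other, the first gate of the
list first. -/
def op {W : Type} [Fintype W] [DecidableEq W] (Q : Circuit W) : QState W →ₗ[ℂ] QState W :=
  Q.allGates.foldl (fun U g => g.op ∘ₗ U) LinearMap.id

/-- `Q` implements the operator `U` on the `m`-qubit register using `a` dirty ancilla qubits:
whatever the state `ψ` of the ancilla qubits is, `U` is applied to the register and the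
ancilla qubits are returned to the state `ψ`. -/
def ImplementsDirty {m a : ℕ} (Q : Circuit (Fin m ⊕ Fin a))
    (U : QState (Fin m) →ₗ[ℂ] QState (Fin m)) : Prop :=
  ∀ (φ : QState (Fin m)) (ψ : QState (Fin a)),
    Q.op (tensorState φ ψ) = tensorState (U φ) ψ

end Circuit

/-- The integer `∑ i, x i * 2 ^ i` with binary digits `x`; digit `0` is the least significant. -/
def bitsVal {n : ℕ} (x : Bits (Fin n)) : ℕ := ∑ i : Fin n, (x i).toNat * 2 ^ (i : ℕ)

/-- The `n` low-order binary digits of `v`. -/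
def toBits (n v : ℕ) : Bits (Fin n) := fun i => v.testBit (i : ℕ)

/-- `x ↦ (x + 1) mod 2 ^ n` on `n`-bit strings. -/
def incBits (n : ℕ) (x : Bits (Fin n)) : Bits (Fin n) := toBits n ((bitsVal x + 1) % 2 ^ n)

/-- `x ↦ (x - 1) mod 2 ^ n` on `n`-bit strings. -/
def decBits (n : ℕ) (x : Bits (Fin n)) : Bits (Fin n) :=
  toBits n ((bitsVal x + (2 ^ n - 1)) % 2 ^ n)

/-- The first `k` bits are controls: `f` is applied to the last `n` bits iff all of them
are `1`. -/
def controlledBits (k : ℕ) {n : ℕ} (f : Bits (Fin n) → Bits (Fin n))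
    (x : Bits (Fin (k + n))) : Bits (Fin (k + n)) :=
  if ∀ i : Fin k, x (Fin.castAdd n i) = true then
    Fin.append (fun i => x (Fin.castAdd n i)) (f fun j => x (Fin.natAdd k j))
  else x

/-- `f` applied to the first `k` of `k + n` bits. -/
def onFirstBits {k : ℕ} (n : ℕ) (f : Bits (Fin k) → Bits (Fin k))
    (x : Bits (Fin (k + n))) : Bits (Fin (k + n)) :=
  Fin.append (f fun i => x (Fin.castAdd n i)) (fun j => x (Fin.natAdd k j))

/-- The `n`-bit increment operator `|x⟩ ↦ |(x + 1) mod 2 ^ n⟩`. -/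
def incOp (n : ℕ) : QState (Fin n) →ₗ[ℂ] QState (Fin n) := basisOp (incBits n)

/-- The `k`-controlled `n`-bit increment operator; the first `k` qubits are the controls. -/
def controlledIncOp (k n : ℕ) : QState (Fin (k + n)) →ₗ[ℂ] QState (Fin (k + n)) :=
  basisOp (controlledBits k (incBits n))

/-- The `k`-bit decrement operator on the first `k` of `k + n` qubits (the identity on the
others). -/
def decFirstOp (k n : ℕ) : QState (Fin (k + n)) →ₗ[ℂ] QState (Fin (k + n)) :=
  basisOp (onFirstBits n (decBits k))

/-! Bit i of x + 1 is x_i xor the conjunction of the bits below it (`incBits_apply`). Hence an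
increment of k + n bits acts on its first k bits as an increment, which the decrement undoes, and
toggles each later bit by the conjunction of all controls and of the target bits below it. This is
(i). For (ii) it remains to increment with linear size and logarithmic depth while borrowing one
wire d of unknown content (`exists_increment_circuit`); the decrement is an inverse circuit.

Carries are prefix conjunctions, which a tree computes in logarithmic depth, but the tree needs
clean wires. Three devices supply them. Carries can be erased after use, because the complement of
an incremented number has the same carries as the number itself (`allOn_not_incOn`). Wherever a
carry arrives, all lower bits are 1, so lower wires have known content and serve as workspace.
Finally, let Z add d to x, correctly only if its workspace holds 1, and let M be a controlled
complementation of x and d. If the control is off, and Z does not switch it on, then Z⁻¹ M Z is the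
identity whatever Z does. If it is on, x becomes the complement of x + d, minus 1 - d, which is the
complement of x + 1: the unknown d drops out.

The wires are cut into a low part of 2t + 32 wires and t = O(log n) blocks above it, eight of each
size before the size doubles. So every block finds workspace right below it, and nine rounds handle
all blocks (`BlockLayout`). The first t low wires hold flags saying which blocks consist of ones,
the next t hold the carries into the blocks, chained serially in depth t. A block that receives a
carry is first reflected, x ↦ complement of x + 1, and not incremented: reflection fixes a block of
ones, so the workspace of other blocks survives. Complementing these blocks afterwards completes the
increment (`incBlocks`, valid if the low part holds ones). The third device makes it an increment
controlled by the low part (`incHigh`), and the low part, of size O(log n), is incremented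
recursively.

For the lower bounds, a gate touches at most three wires. So an output bit depends on at most 3 ^
depth inputs, while the top output bit depends on every register wire; and every register wire must
be touched by some gate. -/

section Library

/-! ### Local permutations of basis states -/

variable {W : Type}

/-- `f` only acts on the wires in `S`: the others are neither changed nor read. -/
def IsLocal (S : Set W) (f : Equiv.Perm (Bits W)) : Prop :=
  (∀ x, ∀ w ∉ S, f x w = x w) ∧
    ∀ x y : Bits W, (∀ w ∈ S, x w = y w) → ∀ w ∈ S, f x w = f y w

theorem IsLocal.mono {S T : Set W} {f : Equiv.Perm (Bits W)} (h : IsLocal S f) (hST : S ⊆ T) :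
    IsLocal T f := by
  refine ⟨fun x w hw => h.1 x w fun h' => hw (hST h'), fun x y hxy w hw => ?_⟩
  by_cases hS : w ∈ S
  · exact h.2 x y (fun v hv => hxy v (hST hv)) w hS
  · rw [h.1 x w hS, h.1 y w hS, hxy w hw]

theorem IsLocal.one (S : Set W) : IsLocal S 1 := ⟨fun _ _ _ => rfl, fun _ _ h => h⟩

theorem IsLocal.mul {S : Set W} {f g : Equiv.Perm (Bits W)} (hf : IsLocal S f)
    (hg : IsLocal S g) : IsLocal S (f * g) :=
  ⟨fun x w hw => (hf.1 _ w hw).trans (hg.1 x w hw),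
    fun x y hxy w hw => hf.2 _ _ (fun v hv => hg.2 x y hxy v hv) w hw⟩

theorem IsLocal.commute {S T : Set W} {f g : Equiv.Perm (Bits W)} (hf : IsLocal S f)
    (hg : IsLocal T g) (hST : Disjoint S T) : f * g = g * f := by
  ext x w
  simp only [Equiv.Perm.mul_apply]
  by_cases hS : w ∈ S
  · have hT : w ∉ T := Set.disjoint_left.1 hST hS
    rw [hg.1 _ w hT]
    exact hf.2 (g x) x (fun v hv => hg.1 x v (Set.disjoint_left.1 hST hv)) w hS
  · rw [hf.1 _ w hS]
    by_cases hT : w ∈ T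
    · exact (hg.2 (f x) x (fun v hv => hf.1 x v (Set.disjoint_right.1 hST hv)) w hT).symm
    · rw [hg.1 _ w hT, hg.1 _ w hT, hf.1 _ w hS]

/-- Changing wires outside the support of `f` commutes with undoing `f`. -/
theorem IsLocal.inv_apply {S : Set W} {f : Equiv.Perm (Bits W)} (hf : IsLocal S f)
    {x y z : Bits W} (hy : ∀ w ∈ S, y w = f x w) (hz : ∀ w ∈ S, z w = x w)
    (hz' : ∀ w ∉ S, z w = y w) : f⁻¹ y = z := by
  rw [Equiv.Perm.inv_eq_iff_eq]
  funext w
  by_cases hw : w ∈ S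
  · rw [hy w hw, hf.2 z x hz w hw]
  · rw [hf.1 z w hw, hz' w hw]

variable [DecidableEq W]

theorem Gate.act_act (g : Gate W) (x : Bits W) : g.act (g.act x) = x := by
  cases g with
  | X t => funext w; by_cases h : w = t <;> simp [Gate.act, h]
  | CX c t h => funext w; by_cases hw : w = t <;> simp [Gate.act, hw, h]
  | CCX a b t _ h₁ h₂ => funext w; by_cases hw : w = t <;> simp [Gate.act, hw, h₁, h₂]

/-- The action of a gate as a permutation of the basis states. -/
def Gate.perm (g : Gate W) : Equiv.Perm (Bits W) := Function.Involutive.toPerm g.act g.act_act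

@[simp] theorem Gate.perm_apply (g : Gate W) (x : Bits W) : g.perm x = g.act x := rfl

theorem Gate.perm_mul_self (g : Gate W) : g.perm * g.perm = 1 := by
  ext1 x; exact g.act_act x

/-- The permutation carried out by a list of gates, first gate of the list first. -/
def runGates : List (Gate W) → Equiv.Perm (Bits W)
  | [] => 1
  | g :: L => runGates L * g.perm

@[simp] theorem runGates_append (L M : List (Gate W)) :
    runGates (L ++ M) = runGates M * runGates L := by
  induction L with
  | nil => simp [runGates]
  | cons g L ih => simp [runGates, ih, mul_assoc]

theorem runGates_reverse (L : List (Gate W)) : runGates L.reverse = (runGates L)⁻¹ := by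
  induction L with
  | nil => simp [runGates]
  | cons g L ih =>
    have : g.perm⁻¹ = g.perm := inv_eq_of_mul_eq_one_left g.perm_mul_self
    simp [runGates, ih, this]

theorem Gate.isLocal (g : Gate W) : IsLocal (g.support : Set W) g.perm := by
  cases g with
  | X t =>
    refine ⟨fun x w hw => ?_, fun x y hxy w hw => ?_⟩
    · simp only [support, Finset.coe_singleton, Set.mem_singleton_iff] at hw
      simp [act, hw]
    · simp only [support, Finset.coe_singleton, Set.mem_singleton_iff] at hw hxy
      simp [act, hw, hxy]
  | CX c t h =>
    refine ⟨fun x w hw => ?_, fun x y hxy w hw => ?_⟩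
    · simp [support] at hw
      simp [act, hw]
    · simp [support] at hw hxy
      by_cases hwt : w = t
      · simp [act, hwt, hxy]
      · rcases hw with rfl | rfl <;> simp [act, hxy, h]
  | CCX a b t h₁₂ h₁ h₂ =>
    refine ⟨fun x w hw => ?_, fun x y hxy w hw => ?_⟩
    · simp [support] at hw
      simp [act, hw]
    · simp [support] at hw hxy
      by_cases hwt : w = t
      · simp [act, hwt, hxy]
      · rcases hw with rfl | rfl | rfl <;> simp [act, hxy, h₁, h₂]

theorem isLocal_runGates {S : Set W} {L : List (Gate W)}
    (h : ∀ γ ∈ L, (γ.support : Set W) ⊆ S) : IsLocal S (runGates L) := by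
  induction L with
  | nil => exact .one S
  | cons g L ih =>
    exact (ih fun γ hγ => h γ (by simp [hγ])).mul (g.isLocal.mono (h g (by simp)))

/-- Some circuit with at most `g` gates and depth at most `d`, acting on the wires in `S` only,
carries out the permutation `f` of the basis states. -/
def Realizes (S : Set W) (g d : ℕ) (f : Equiv.Perm (Bits W)) : Prop :=
  ∃ Q : Circuit W, (∀ γ ∈ Q.allGates, (γ.support : Set W) ⊆ S) ∧
    runGates Q.allGates = f ∧ Q.gateCount ≤ g ∧ Q.depth ≤ d

/-! ### Composing circuits in series and in parallel -/

namespace Realizes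

theorem isLocal {S : Set W} {g d : ℕ} {f : Equiv.Perm (Bits W)} (h : Realizes S g d f) :
    IsLocal S f := by
  obtain ⟨Q, hS, rfl, -, -⟩ := h
  exact isLocal_runGates hS

theorem mono {S T : Set W} {g d g' d' : ℕ} {f : Equiv.Perm (Bits W)} (h : Realizes S g d f)
    (hS : S ⊆ T) (hg : g ≤ g') (hd : d ≤ d') : Realizes T g' d' f := by
  obtain ⟨Q, h₁, h₂, h₃, h₄⟩ := h
  exact ⟨Q, fun γ hγ => (h₁ γ hγ).trans hS, h₂, h₃.trans hg, h₄.trans hd⟩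

theorem one (S : Set W) (g d : ℕ) : Realizes S g d 1 :=
  ⟨[], by simp [Circuit.allGates], by simp [Circuit.allGates, runGates],
    by simp [Circuit.gateCount, Circuit.allGates], by simp [Circuit.depth]⟩

theorem gate (γ : Gate W) {S : Set W} (h : (γ.support : Set W) ⊆ S) :
    Realizes S 1 1 γ.perm :=
  ⟨[⟨[γ], by simp⟩], by simpa [Circuit.allGates] using h, by simp [Circuit.allGates, runGates],
    by simp [Circuit.gateCount, Circuit.allGates], by simp [Circuit.depth]⟩

theorem mul {S : Set W} {g₁ d₁ g₂ d₂ : ℕ} {f₁ f₂ : Equiv.Perm (Bits W)}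
    (h₂ : Realizes S g₂ d₂ f₂) (h₁ : Realizes S g₁ d₁ f₁) :
    Realizes S (g₂ + g₁) (d₂ + d₁) (f₂ * f₁) := by
  obtain ⟨Q₁, a₁, rfl, c₁, e₁⟩ := h₁
  obtain ⟨Q₂, a₂, rfl, c₂, e₂⟩ := h₂
  refine ⟨Q₁ ++ Q₂, ?_, ?_, ?_, ?_⟩
  · intro γ hγ
    rw [Circuit.allGates, List.flatMap_append, List.mem_append] at hγ
    exact hγ.elim (a₁ γ) (a₂ γ)
  · simp [Circuit.allGates, List.flatMap_append]
  · simp only [Circuit.gateCount, Circuit.allGates, List.flatMap_append, List.length_append]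
      at c₁ c₂ ⊢
    omega
  · simp only [Circuit.depth, List.length_append] at e₁ e₂ ⊢
    omega

theorem inv {S : Set W} {g d : ℕ} {f : Equiv.Perm (Bits W)} (h : Realizes S g d f) :
    Realizes S g d f⁻¹ := by
  obtain ⟨Q, a, rfl, c, e⟩ := h
  let r : Layer W → Layer W := fun l =>
    ⟨l.gates.reverse, List.pairwise_reverse.2 (l.disjoint.imp fun h => h.symm)⟩
  have key : Circuit.allGates (Q.map r).reverse = Q.allGates.reverse := by
    clear a c e
    induction Q with
    | nil => rfl
    | cons l Q ih =>
      simp only [Circuit.allGates] at ih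
      simp [Circuit.allGates, List.flatMap_append, ih, r]
  refine ⟨(Q.map r).reverse, ?_, ?_, ?_, ?_⟩
  · rw [key]; simpa using a
  · rw [key, runGates_reverse]
  · rw [Circuit.gateCount, key, List.length_reverse]; exact c
  · simpa [Circuit.depth] using e

/-- The layers are merged pairwise, and the longer circuit continues alone. Operations on disjoint
wires commute, so interleaving them does not matter. -/
theorem exists_parallel {S T : Set W} (hST : Disjoint S T) (Q₁ Q₂ : Circuit W)
    (a₁ : ∀ γ ∈ Q₁.allGates, (γ.support : Set W) ⊆ S)
    (a₂ : ∀ γ ∈ Q₂.allGates, (γ.support : Set W) ⊆ T) :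
    ∃ Q : Circuit W, (∀ γ ∈ Q.allGates, (γ.support : Set W) ⊆ S ∪ T) ∧
      runGates Q.allGates = runGates Q₁.allGates * runGates Q₂.allGates ∧
      Q.gateCount = Q₁.gateCount + Q₂.gateCount ∧ Q.depth = max Q₁.depth Q₂.depth := by
  induction Q₁ generalizing Q₂ with
  | nil =>
    exact ⟨Q₂, fun γ hγ => (a₂ γ hγ).trans Set.subset_union_right,
      by simp [Circuit.allGates, runGates], by simp [Circuit.gateCount, Circuit.allGates],
      by simp [Circuit.depth]⟩
  | cons l₁ Q₁ ih =>
    cases Q₂ with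
    | nil =>
      exact ⟨l₁ :: Q₁, fun γ hγ => (a₁ γ hγ).trans Set.subset_union_left,
        by simp [Circuit.allGates, runGates], by simp [Circuit.gateCount, Circuit.allGates],
        by simp [Circuit.depth]⟩
    | cons l₂ Q₂ =>
      simp only [Circuit.allGates, List.flatMap_cons, List.mem_append] at a₁ a₂
      obtain ⟨Q, b₁, b₂, b₃, b₄⟩ := ih Q₂ (fun γ hγ => a₁ γ (.inr hγ))
        (fun γ hγ => a₂ γ (.inr hγ))
      have hl : (l₁.gates ++ l₂.gates).Pairwise fun g h => Disjoint g.support h.support := by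
        refine List.pairwise_append.2 ⟨l₁.disjoint, l₂.disjoint, fun γ hγ δ hδ => ?_⟩
        exact Finset.disjoint_coe.1 (hST.mono (a₁ γ (.inl hγ)) (a₂ δ (.inl hδ)))
      refine ⟨⟨l₁.gates ++ l₂.gates, hl⟩ :: Q, ?_, ?_, ?_, ?_⟩
      · intro γ hγ
        simp only [Circuit.allGates, List.flatMap_cons, List.mem_append] at hγ
        rcases hγ with (h | h) | h
        · exact (a₁ γ (.inl h)).trans Set.subset_union_left
        · exact (a₂ γ (.inl h)).trans Set.subset_union_right
        · exact b₁ γ h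
      · have c₁ : IsLocal S (runGates l₁.gates) := isLocal_runGates fun γ h => a₁ γ (.inl h)
        have c₂ : IsLocal T (runGates l₂.gates) := isLocal_runGates fun γ h => a₂ γ (.inl h)
        have c₃ : IsLocal T (runGates (Circuit.allGates Q₂)) :=
          isLocal_runGates fun γ h => a₂ γ (.inr h)
        -- The first layer of `Q₁` has to move past all of the second circuit.
        have := c₁.commute (c₃.mul c₂) hST
        simp only [Circuit.allGates, List.flatMap_cons, runGates_append] at b₂ this ⊢
        rw [b₂]
        simp only [mul_assoc] at this ⊢
        rw [this]
      · simp only [Circuit.gateCount, Circuit.allGates, List.flatMap_cons, List.length_append]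
          at b₃ ⊢
        omega
      · simp only [Circuit.depth, List.length_cons] at b₄ ⊢
        omega

theorem parallel {S T : Set W} {g₁ g₂ d : ℕ} {f₁ f₂ : Equiv.Perm (Bits W)}
    (h₁ : Realizes S g₁ d f₁) (h₂ : Realizes T g₂ d f₂) (hST : Disjoint S T) :
    Realizes (S ∪ T) (g₁ + g₂) d (f₁ * f₂) := by
  obtain ⟨Q₁, a₁, rfl, c₁, e₁⟩ := h₁
  obtain ⟨Q₂, a₂, rfl, c₂, e₂⟩ := h₂
  obtain ⟨Q, b₁, b₂, b₃, b₄⟩ := exists_parallel hST Q₁ Q₂ a₁ a₂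
  exact ⟨Q, b₁, b₂, by omega, by rw [b₄]; exact max_le e₁ e₂⟩

/-- Operations on pairwise disjoint sets of wires can be carried out simultaneously. -/
theorem family {ι : Type} [DecidableEq ι] (J : Finset ι) {S : ι → Set W} {g : ι → ℕ} {d : ℕ}
    {f : ι → Equiv.Perm (Bits W)} (h : ∀ j ∈ J, Realizes (S j) (g j) d (f j))
    (hS : ∀ i ∈ J, ∀ j ∈ J, i ≠ j → Disjoint (S i) (S j)) :
    ∃ F, Realizes (⋃ j ∈ J, S j) (∑ j ∈ J, g j) d F ∧
      (∀ x, ∀ j ∈ J, ∀ w ∈ S j, F x w = f j x w) ∧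
      ∀ (st : Finset ι → Bits W) (K : Finset ι), Disjoint K J →
        (∀ K' : Finset ι, ∀ j ∈ J, j ∉ K' → f j (st K') = st (insert j K')) →
        F (st K) = st (K ∪ J) := by
  induction J using Finset.induction_on with
  | empty => exact ⟨1, .one _ _ _, by simp, by simp⟩
  | insert i J hi ih =>
    obtain ⟨F, h₁, h₂, h₃⟩ := ih (fun j hj => h j (by simp [hj]))
      (fun a ha b hb => hS a (by simp [ha]) b (by simp [hb]))
    have hdis : Disjoint (S i) (⋃ j ∈ J, S j) := by
      simp only [Set.disjoint_iUnion_right]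
      exact fun j hj => hS i (by simp) j (by simp [hj]) (by rintro rfl; exact hi hj)
    have hi' := h i (by simp)
    refine ⟨f i * F, ?_, ?_, ?_⟩
    · refine (hi'.parallel h₁ hdis).mono ?_ ?_ le_rfl
      · simp
      · rw [Finset.sum_insert hi]
    · intro x j hj w hw
      rw [Equiv.Perm.mul_apply]
      rcases Finset.mem_insert.1 hj with rfl | hj
      · exact hi'.isLocal.2 _ _ (fun v hv => h₁.isLocal.1 x v (Set.disjoint_left.1 hdis hv)) w hw
      · rw [hi'.isLocal.1 _ w, h₂ x j hj w hw]
        exact Set.disjoint_right.1 hdis (Set.mem_biUnion hj hw)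
    · intro st K hK hst
      rw [Equiv.Perm.mul_apply, h₃ st K (hK.mono_right (by simp)) fun K' j hj =>
        hst K' j (by simp [hj]), hst _ i (by simp), Finset.union_insert]
      simp only [Finset.mem_union, hi, or_false]
      exact fun hiK => Finset.disjoint_left.1 hK hiK (by simp)

/-- If the operations `f j` and `f j'` act on disjoint sets of wires whenever `j ≡ j'` modulo `R`,
then all of them can be carried out in `R` rounds. -/
theorem rounds (R t : ℕ) (hR : 0 < R) {S : ℕ → Set W} {g : ℕ → ℕ} {d : ℕ}
    {f : ℕ → Equiv.Perm (Bits W)} (h : ∀ j < t, Realizes (S j) (g j) d (f j))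
    (hS : ∀ i < t, ∀ j < t, i < j → i % R = j % R → Disjoint (S i) (S j)) :
    ∃ F, Realizes (⋃ j ∈ Finset.range t, S j) (∑ j ∈ Finset.range t, g j) (R * d) F ∧
      ∀ st : Finset ℕ → Bits W,
        (∀ K : Finset ℕ, ∀ j < t, j ∉ K → f j (st K) = st (insert j K)) →
        F (st ∅) = st (Finset.range t) := by
  -- Round r runs the operations with index congruent to r. Since `st K` depends only on the set `K`
  -- already processed, the order in which indices are taken does not matter.
  have main : ∀ r, ∃ F, Realizes (⋃ j ∈ Finset.range t, S j)
      (∑ j ∈ (Finset.range t).filter (fun j => j % R < r), g j) (r * d) F ∧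
      ∀ st : Finset ℕ → Bits W,
        (∀ K : Finset ℕ, ∀ j < t, j ∉ K → f j (st K) = st (insert j K)) →
        F (st ∅) = st ((Finset.range t).filter (fun j => j % R < r)) := by
    intro r
    induction r with
    | zero => exact ⟨1, .one _ _ _, by simp⟩
    | succ r ih =>
      obtain ⟨F, h₁, h₂⟩ := ih
      obtain ⟨G, k₁, -, k₃⟩ := family ((Finset.range t).filter (fun j => j % R = r))
        (S := S) (g := g) (f := f) (d := d)
        (fun j hj => h j (by simp at hj; exact hj.1)) (by
          intro i hi j hj hij
          simp only [Finset.mem_filter, Finset.mem_range] at hi hj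
          rcases lt_or_gt_of_ne hij with hlt | hlt
          · exact hS i hi.1 j hj.1 hlt (by omega)
          · exact (hS j hj.1 i hi.1 hlt (by omega)).symm)
      have hd : Disjoint ((Finset.range t).filter (fun j => j % R < r))
          ((Finset.range t).filter (fun j => j % R = r)) := by
        rw [Finset.disjoint_filter]; intros; omega
      have hu : (Finset.range t).filter (fun j => j % R < r) ∪
          (Finset.range t).filter (fun j => j % R = r) =
          (Finset.range t).filter (fun j => j % R < r + 1) := by
        ext j; simp only [Finset.mem_union, Finset.mem_filter]
        constructor
        · rintro (h | h) <;> exact ⟨h.1, by omega⟩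
        · intro h
          rcases Nat.lt_succ_iff_lt_or_eq.1 h.2 with h' | h'
          · exact .inl ⟨h.1, h'⟩
          · exact .inr ⟨h.1, h'⟩
      refine ⟨G * F, ?_, ?_⟩
      · refine ((k₁.mono ?_ le_rfl le_rfl).mul h₁).mono subset_rfl ?_ ?_
        · exact Set.biUnion_subset_biUnion_left fun j hj => (Finset.mem_filter.1 hj).1
        · rw [← hu, Finset.sum_union hd, add_comm]
        · rw [Nat.succ_mul, add_comm]
      · intro st hst
        rw [Equiv.Perm.mul_apply, h₂ st hst, k₃ st _ hd, hu]
        intro K j hj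
        exact hst K j (by simp at hj; exact hj.1)
  obtain ⟨F, h₁, h₂⟩ := main R
  have : (Finset.range t).filter (fun j => j % R < R) = Finset.range t :=
    Finset.filter_true_of_mem fun j _ => Nat.mod_lt j hR
  rw [this] at h₁ h₂
  exact ⟨F, h₁, h₂⟩

/-- A layer of `X` gates. -/
theorem notLayer (n : ℕ) (t : ℕ → W) (ht : ∀ i < n, ∀ j < n, t i = t j → i = j) :
    ∃ F, Realizes {w | ∃ i < n, w = t i} n 1 F ∧
      (∀ x, ∀ i < n, F x (t i) = !(x (t i))) ∧
      ∀ x w, (∀ i < n, w ≠ t i) → F x w = x w := by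
  obtain ⟨F, h₁, h₂, -⟩ := family (Finset.range n) (S := fun i => {t i}) (g := fun _ => 1)
    (d := 1) (f := fun i => (Gate.X (t i)).perm)
    (fun i _ => gate _ (by simp [Gate.support])) (by
      intro i hi j hj hij
      simp only [Finset.mem_range] at hi hj
      simpa using fun h => hij (ht i hi j hj h))
  refine ⟨F, h₁.mono ?_ (by simp) le_rfl, ?_, ?_⟩
  · intro w hw; simpa [eq_comm] using hw
  · intro x i hi
    rw [h₂ x i (by simpa using hi) (t i) (by simp)]
    simp [Gate.act]
  · intro x w hw
    exact h₁.isLocal.1 x w (by simpa using hw)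

/-- A layer of `CX` gates. -/
theorem cxLayer (n : ℕ) (c t : ℕ → W) (hc : ∀ i < n, ∀ j < n, c i = c j → i = j)
    (ht : ∀ i < n, ∀ j < n, t i = t j → i = j) (hct : ∀ i < n, ∀ j < n, c i ≠ t j) :
    ∃ F, Realizes {w | ∃ i < n, w = c i ∨ w = t i} n 1 F ∧
      (∀ x, ∀ i < n, F x (t i) = xor (x (t i)) (x (c i))) ∧
      ∀ x w, (∀ i < n, w ≠ t i) → F x w = x w := by
  let f : ℕ → Equiv.Perm (Bits W) := fun i =>
    if h : i < n then (Gate.CX (c i) (t i) (hct i h i h)).perm else 1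
  obtain ⟨F, h₁, h₂, -⟩ := family (Finset.range n) (S := fun i => {c i, t i}) (g := fun _ => 1)
    (d := 1) (f := f)
    (fun i hi => by
      simp only [Finset.mem_range] at hi
      simp only [f, hi, dif_pos]
      exact gate _ (by simp [Gate.support])) (by
      intro i hi j hj hij
      simp only [Finset.mem_range] at hi hj
      rw [Set.disjoint_left]
      rintro w (rfl | rfl) (h | h)
      · exact hij (hc i hi j hj h)
      · exact hct i hi j hj h
      · exact hct j hj i hi h.symm
      · exact hij (ht i hi j hj h))
  refine ⟨F, h₁.mono ?_ (by simp) le_rfl, ?_, ?_⟩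
  · intro w hw; simpa using hw
  · intro x i hi
    rw [h₂ x i (by simpa using hi) (t i) (by simp)]
    simp [f, hi, Gate.act]
  · intro x w hw
    by_cases hw' : ∃ i < n, w = c i
    · obtain ⟨i, hi, rfl⟩ := hw'
      rw [h₂ x i (by simpa using hi) _ (by simp)]
      simp [f, hi, Gate.act, hct i hi i hi]
    · exact h₁.isLocal.1 x w (by
        simp only [Finset.mem_range, Set.mem_iUnion, not_exists]
        rintro i hi (h | h)
        · exact hw' ⟨i, hi, h⟩
        · exact hw i hi h)

/-- A layer of `CCX` gates. -/
theorem ccxLayer (n : ℕ) (a b t : ℕ → W) (ha : ∀ i < n, ∀ j < n, a i = a j → i = j)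
    (hb : ∀ i < n, ∀ j < n, b i = b j → i = j) (ht : ∀ i < n, ∀ j < n, t i = t j → i = j)
    (hab : ∀ i < n, ∀ j < n, a i ≠ b j) (hat : ∀ i < n, ∀ j < n, a i ≠ t j)
    (hbt : ∀ i < n, ∀ j < n, b i ≠ t j) :
    ∃ F, Realizes {w | ∃ i < n, w = a i ∨ w = b i ∨ w = t i} n 1 F ∧
      (∀ x, ∀ i < n, F x (t i) = xor (x (t i)) (x (a i) && x (b i))) ∧
      ∀ x w, (∀ i < n, w ≠ t i) → F x w = x w := by
  let f : ℕ → Equiv.Perm (Bits W) := fun i =>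
    if h : i < n then
      (Gate.CCX (a i) (b i) (t i) (hab i h i h) (hat i h i h) (hbt i h i h)).perm else 1
  obtain ⟨F, h₁, h₂, -⟩ := family (Finset.range n) (S := fun i => {a i, b i, t i})
    (g := fun _ => 1) (d := 1) (f := f)
    (fun i hi => by
      simp only [Finset.mem_range] at hi
      simp only [f, hi, dif_pos]
      exact gate _ (by simp [Gate.support])) (by
      intro i hi j hj hij
      simp only [Finset.mem_range] at hi hj
      rw [Set.disjoint_left]
      rintro w (rfl | rfl | rfl) (h | h | h)
      · exact hij (ha i hi j hj h)
      · exact hab i hi j hj h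
      · exact hat i hi j hj h
      · exact hab j hj i hi h.symm
      · exact hij (hb i hi j hj h)
      · exact hbt i hi j hj h
      · exact hat j hj i hi h.symm
      · exact hbt j hj i hi h.symm
      · exact hij (ht i hi j hj h))
  refine ⟨F, h₁.mono ?_ (by simp) le_rfl, ?_, ?_⟩
  · intro w hw; simpa using hw
  · intro x i hi
    rw [h₂ x i (by simpa using hi) (t i) (by simp)]
    simp [f, hi, Gate.act]
  · intro x w hw
    by_cases hw' : ∃ i < n, w = a i ∨ w = b i
    · obtain ⟨i, hi, h⟩ := hw'
      rw [h₂ x i (by simpa using hi) _ (by rcases h with h | h <;> simp [h])]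
      simp [f, hi, Gate.act, hw i hi]
    · exact h₁.isLocal.1 x w (by
        simp only [Finset.mem_range, Set.mem_iUnion, not_exists]
        rintro i hi (h | h | h)
        · exact hw' ⟨i, hi, .inl h⟩
        · exact hw' ⟨i, hi, .inr h⟩
        · exact hw i hi h)

end Realizes

end Library

/-! ### Conjunctions of initial segments -/

/-- The conjunction of the first `n` values of `y`. -/
def andBelow (y : ℕ → Bool) : ℕ → Bool
  | 0 => true
  | n + 1 => andBelow y n && y n

theorem andBelow_eq_true {y : ℕ → Bool} {n : ℕ} :
    andBelow y n = true ↔ ∀ l < n, y l = true := by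
  induction n with
  | zero => simp [andBelow]
  | succ n ih =>
    simp only [andBelow, Bool.and_eq_true, ih, Nat.lt_succ_iff_lt_or_eq]
    constructor
    · rintro ⟨h, h'⟩ l (hl | rfl)
      · exact h l hl
      · exact h'
    · exact fun h => ⟨fun l hl => h l (.inl hl), h n (.inr rfl)⟩

theorem andBelow_congr {y z : ℕ → Bool} {n : ℕ} (h : ∀ l < n, y l = z l) :
    andBelow y n = andBelow z n := by
  rw [Bool.eq_iff_iff, andBelow_eq_true, andBelow_eq_true]
  exact forall₂_congr fun l hl => by rw [h l hl]

theorem andBelow_pairs (z : ℕ → Bool) (j : ℕ) :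
    andBelow (fun l => z (2 * l) && z (2 * l + 1)) j = andBelow z (2 * j) := by
  induction j with
  | zero => rfl
  | succ j ih => rw [andBelow, ih, Nat.mul_succ, andBelow, andBelow, Bool.and_assoc]

theorem andBelow_add (z : ℕ → Bool) (m n : ℕ) :
    andBelow z (m + n) = (andBelow z m && andBelow (fun i => z (m + i)) n) := by
  induction n with
  | zero => simp [andBelow]
  | succ n ih => rw [← Nat.add_assoc, andBelow, ih, andBelow, Bool.and_assoc]

/-! ### Fan-out, multiply controlled NOT and prefix conjunctions -/

section Subcircuits

variable {W : Type} [DecidableEq W]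

namespace Realizes

/-- Fan-out of the wire `c` to `n` wires in logarithmic depth. -/
theorem fanOut (k : ℕ) : ∀ n ≤ 2 ^ k, ∀ (c : W) (t : ℕ → W),
    (∀ i < n, ∀ j < n, t i = t j → i = j) → (∀ i < n, c ≠ t i) →
    ∃ F, Realizes {w | w = c ∨ ∃ i < n, w = t i} (2 * n) (2 * k + 1) F ∧
      (∀ x, ∀ i < n, F x (t i) = xor (x (t i)) (x c)) ∧
      ∀ x w, (∀ i < n, w ≠ t i) → F x w = x w := by
  induction k with
  | zero =>
    intro n hn c t ht hc
    obtain ⟨F, h₁, h₂, h₃⟩ := cxLayer n (fun _ => c) t (fun i hi j hj _ => by omega) ht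
      (fun i _ j hj => hc j hj)
    refine ⟨F, h₁.mono ?_ (by omega) le_rfl, h₂, h₃⟩
    rintro w ⟨i, hi, h | h⟩
    · exact .inl h
    · exact .inr ⟨i, hi, h⟩
  | succ k ih =>
    intro n hn c t ht hc
    rw [pow_succ] at hn
    obtain ⟨m, r, hm, hr, rfl⟩ : ∃ m r, m ≤ 2 ^ k ∧ r ≤ m ∧ n = m + r :=
      ⟨(n + 1) / 2, n - (n + 1) / 2, by omega, by omega, by omega⟩
    obtain ⟨G, g₁, g₂, g₃⟩ := ih m hm c t (fun i hi j hj => ht i (by omega) j (by omega))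
      (fun i hi => hc i (by omega))
    obtain ⟨L, l₁, l₂, l₃⟩ := cxLayer r t (fun i => t (m + i))
      (fun i hi j hj => ht i (by omega) j (by omega))
      (fun i hi j hj h => by have := ht _ (by omega) _ (by omega) h; omega)
      (fun i hi j hj h => by have := ht _ (by omega) _ (by omega) h; omega)
    have l₁' := l₁.mono (T := {w | w = c ∨ ∃ i < m + r, w = t i}) (by
      rintro w ⟨i, hi, rfl | rfl⟩
      · exact .inr ⟨i, by omega, rfl⟩
      · exact .inr ⟨m + i, by omega, rfl⟩) le_rfl le_rfl
    have g₁' := g₁.mono (T := {w | w = c ∨ ∃ i < m + r, w = t i}) (by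
      rintro w (rfl | ⟨i, hi, rfl⟩)
      · exact .inl rfl
      · exact .inr ⟨i, by omega, rfl⟩) le_rfl le_rfl
    -- Copying the first half onto the second both before and after `G` cancels the old values of
    -- the first half; only their change, the bit of `c`, is passed on.
    refine ⟨L * (G * L), (l₁'.mul (g₁'.mul l₁')).mono subset_rfl (by omega) (by omega), ?_, ?_⟩
    · intro x i hi
      have low : ∀ z, ∀ i < m, L z (t i) = z (t i) := fun z i hi =>
        l₃ z _ fun j hj h => by have := ht _ (by omega) _ (by omega) h; omega
      have hLc : L x c = x c := l₃ x c fun j hj => hc _ (by omega)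
      have hGL : ∀ i < m, (G (L x)) (t i) = xor (x (t i)) (x c) := fun i hi => by
        rw [g₂ _ i hi, low x i hi, hLc]
      simp only [Equiv.Perm.mul_apply]
      rcases lt_or_ge i m with h | h
      · rw [low _ i h, hGL i h]
      · obtain ⟨j, rfl⟩ := Nat.exists_eq_add_of_le h
        rw [l₂ _ j (by omega), hGL j (by omega), g₃ _ _ (fun i' hi' h' => by
          have := ht _ (by omega) _ (by omega) h'; omega), l₂ _ j (by omega)]
        cases x (t (m + j)) <;> cases x (t j) <;> cases x c <;> rfl
    · intro x w hw
      simp only [Equiv.Perm.mul_apply]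
      rw [l₃ _ w (fun i hi => hw _ (by omega)), g₃ _ w (fun i hi => hw _ (by omega)),
        l₃ _ w (fun i hi => hw _ (by omega))]

/-- Toggling arbitrary wires `g j` by the conjunctions of the first `j + 1` controls. -/
theorem ladder (m : ℕ) (a g : ℕ → W) (ha : ∀ i < m, ∀ j < m, a i = a j → i = j)
    (hg : ∀ i < m, ∀ j < m, g i = g j → i = j) (hag : ∀ i < m, ∀ j < m, a i ≠ g j) :
    ∃ F, Realizes {w | ∃ i < m, w = a i ∨ w = g i} (2 * m) (2 * m) F ∧
      (∀ x, ∀ j < m, F x (g j) = xor (x (g j)) (andBelow (fun l => x (a l)) (j + 1))) ∧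
      ∀ x w, (∀ i < m, w ≠ g i) → F x w = x w := by
  induction m with
  | zero => exact ⟨1, .one _ _ _, by simp, by simp⟩
  | succ m ih =>
    rcases m with - | m
    · refine ⟨(Gate.CX (a 0) (g 0) (hag 0 (by simp) 0 (by simp))).perm,
        (gate _ (by intro w; simp [Gate.support])).mono subset_rfl (by simp) (by simp), ?_, ?_⟩
      · intro x j hj
        obtain rfl : j = 0 := by omega
        simp [Gate.act, andBelow]
      · intro x w hw
        simp [Gate.act, hw 0 (by simp)]
    obtain ⟨F, h₁, h₂, h₃⟩ := ih (fun i hi j hj => ha i (by omega) j (by omega))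
      (fun i hi j hj => hg i (by omega) j (by omega))
      (fun i hi j hj => hag i (by omega) j (by omega))
    set γ : Gate W := Gate.CCX (a (m + 1)) (g m) (g (m + 1)) (hag _ (by omega) _ (by omega))
      (hag _ (by omega) _ (by omega))
      (fun h => by have := hg _ (by omega) _ (by omega) h; omega) with hγ
    have hγ₁ : ∀ x, γ.perm x (g (m + 1)) =
        xor (x (g (m + 1))) (x (a (m + 1)) && x (g m)) := by simp [hγ, Gate.act]
    have hγ₂ : ∀ x w, w ≠ g (m + 1) → γ.perm x w = x w := by
      intro x w hw; simp [hγ, Gate.act, hw]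
    have k₁ : Realizes {w | ∃ i < m + 1 + 1, w = a i ∨ w = g i} 1 1 γ.perm := gate _ (by
      intro w hw
      simp only [hγ, Gate.support, Finset.coe_insert, Finset.coe_singleton,
        Set.mem_insert_iff, Set.mem_singleton_iff] at hw
      rcases hw with rfl | rfl | rfl
      · exact ⟨m + 1, by omega, .inl rfl⟩
      · exact ⟨m, by omega, .inr rfl⟩
      · exact ⟨m + 1, by omega, .inr rfl⟩)
    have h₁' := h₁.mono (T := {w | ∃ i < m + 1 + 1, w = a i ∨ w = g i})
      (fun w ⟨i, hi, h⟩ => ⟨i, by omega, h⟩) le_rfl le_rfl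
    have handa : ∀ x, ∀ j ≤ m + 1, andBelow (fun l => γ.perm x (a l)) j =
        andBelow (fun l => x (a l)) j := fun x j hj =>
      andBelow_congr fun l hl => hγ₂ x _ (hag _ (by omega) _ (by omega))
    -- The wire `g m` is dirty. Firing `γ` before and after `F` toggles `g (m + 1)` only by `a (m +
    -- 1)` times the change of `g m`, which is the conjunction of the first `m + 1` controls.
    refine ⟨γ.perm * (F * γ.perm), (k₁.mul (h₁'.mul k₁)).mono subset_rfl (by omega) (by omega),
      ?_, ?_⟩
    · intro x j hj
      simp only [Equiv.Perm.mul_apply]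
      have hne : ∀ i < m + 1, g i ≠ g (m + 1) := fun i hi h => by
        have := hg _ (by omega) _ (by omega) h; omega
      rcases Nat.lt_succ_iff_lt_or_eq.1 hj with h | rfl
      · rw [hγ₂ _ _ (hne j h), h₂ _ j h, hγ₂ _ _ (hne j h), handa x _ (by omega)]
      · rw [hγ₁, h₃ _ _ (fun i hi => (hne i hi).symm), hγ₁,
          h₃ _ _ (fun i hi => hag _ (by omega) _ (by omega)),
          hγ₂ _ _ (hag _ (by omega) _ (by omega)), h₂ _ m (by omega), hγ₂ _ _ (hne m (by omega)),
          handa x _ le_rfl]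
        conv_rhs => rw [andBelow]
        cases x (g (m + 1)) <;> cases x (a (m + 1)) <;> cases x (g m) <;>
          cases andBelow (fun l => x (a l)) (m + 1) <;> rfl
    · intro x w hw
      simp only [Equiv.Perm.mul_apply]
      rw [hγ₂ _ w (hw _ (by omega)), h₃ _ w (fun i hi => hw i (by omega)),
        hγ₂ _ w (hw _ (by omega))]

/-- A multiply controlled `X` gate of linear size, borrowing `m` wires. -/
theorem multiControlled (m : ℕ) (a g : ℕ → W)
    (ha : ∀ i < m + 1, ∀ j < m + 1, a i = a j → i = j)
    (hg : ∀ i < m + 1, ∀ j < m + 1, g i = g j → i = j)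
    (hag : ∀ i < m + 1, ∀ j < m + 1, a i ≠ g j) :
    ∃ F, Realizes {w | ∃ i < m + 1, w = a i ∨ w = g i} (4 * m + 4) (4 * m + 4) F ∧
      (∀ x, F x (g m) = xor (x (g m)) (andBelow (fun l => x (a l)) (m + 1))) ∧
      ∀ x w, w ≠ g m → F x w = x w := by
  obtain ⟨F, f₁, f₂, f₃⟩ := ladder (m + 1) a g ha hg hag
  obtain ⟨G, g₁, g₂, g₃⟩ := ladder m a g (fun i hi j hj => ha i (by omega) j (by omega))
    (fun i hi j hj => hg i (by omega) j (by omega)) (fun i hi j hj => hag i (by omega) j (by omega))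
  have g₁' := g₁.mono (T := {w | ∃ i < m + 1, w = a i ∨ w = g i})
    (fun w ⟨i, hi, h⟩ => ⟨i, by omega, h⟩) le_rfl le_rfl
  -- The shorter ladder repeats, and so cancels, every toggle of the longer one except that of `g
  -- m`.
  refine ⟨G * F, (g₁'.mul f₁).mono subset_rfl (by omega) (by omega), ?_, ?_⟩
  · intro x
    rw [Equiv.Perm.mul_apply, g₃ _ _ (fun i hi h => by
      have := hg _ (by omega) _ (by omega) h; omega), f₂ x m (by omega)]
  · intro x w hw
    rw [Equiv.Perm.mul_apply]
    by_cases h : ∃ i < m, w = g i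
    · obtain ⟨i, hi, rfl⟩ := h
      rw [g₂ _ i hi, f₂ _ i (by omega), Bool.xor_assoc]
      rw [andBelow_congr (z := fun l => x (a l)) fun l hl =>
        f₃ x _ fun j hj => hag _ (by omega) _ (by omega)]
      simp
    · push Not at h
      rw [g₃ _ w h, f₃ _ w fun i hi => ?_]
      rcases Nat.lt_succ_iff_lt_or_eq.1 hi with hi | rfl
      · exact h i hi
      · exact hw

/-- All prefix conjunctions of `n` wires `u i`, in logarithmic depth, on `2 * n` wires that hold
`0` initially; they end up in the wires `out i`. -/
theorem prefixTree (k : ℕ) : ∀ n ≤ 2 ^ k, ∀ (u : ℕ → ℕ) (G : ℕ),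
    (∀ i < n, ∀ j < n, u i = u j → i = j) → (∀ i < n, u i < G ∨ G + 2 * n ≤ u i) →
    ∃ (F : Equiv.Perm (Bits ℕ)) (out : ℕ → ℕ),
      Realizes {w | (∃ i < n, w = u i) ∨ (G ≤ w ∧ w < G + 2 * n)} (4 * n) (2 * k) F ∧
      (∀ x w, w < G ∨ G + 2 * n ≤ w → F x w = x w) ∧
      (∀ i < n, ∀ j < n, out i = out j → i = j) ∧ out 0 = u 0 ∧
      (∀ i < n, 0 < i → G ≤ out i ∧ out i < G + 2 * n) ∧
      ∀ x, (∀ w, G ≤ w → w < G + 2 * n → x w = false) →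
        ∀ i < n, F x (out i) = andBelow (fun l => x (u l)) (i + 1) := by
  induction k with
  | zero =>
    intro n hn u G hu hG
    refine ⟨1, u, .one _ _ _, fun _ _ _ => rfl, hu, rfl, fun i hi h => by omega, ?_⟩
    intro x hx i hi
    obtain rfl : i = 0 := by omega
    simp [andBelow]
  | succ k ih =>
    intro n hn u G hu hG
    rw [pow_succ] at hn
    set m := n / 2 with hm
    have hu' : ∀ i < n, ∀ j < n, i ≠ j → u i ≠ u j := fun i hi j hj h h' => h (hu i hi j hj h')
    -- Parallel prefix by pairing. Workspace from `G` on: `m` pair conjunctions, then `(n - 1) / 2`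
    -- prefixes of even index, and from `G + n` on the `2 * m` wires of the recursive call on the
    -- pairs.
    obtain ⟨Y, y₁, y₂, y₃⟩ := ccxLayer m (fun i => u (2 * i)) (fun i => u (2 * i + 1))
      (fun i => G + i)
      (fun i hi j hj h => by have := hu _ (by omega) _ (by omega) h; omega)
      (fun i hi j hj h => by have := hu _ (by omega) _ (by omega) h; omega)
      (fun i hi j hj h => by omega)
      (fun i hi j hj => hu' _ (by omega) _ (by omega) (by omega))
      (fun i hi j hj => by have := hG (2 * i) (by omega); omega)
      (fun i hi j hj => by have := hG (2 * i + 1) (by omega); omega)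
    obtain ⟨F, out, f₁, f₂, f₃, f₄, f₅, f₆⟩ := ih m (by omega) (fun i => G + i) (G + n)
      (fun i hi j hj h => by omega) (fun i hi => by omega)
    have hout : ∀ i < m, (i = 0 ∧ out i = G) ∨ (G + n ≤ out i ∧ out i < G + n + 2 * m) := by
      intro i hi
      rcases Nat.eq_zero_or_pos i with rfl | h
      · exact .inl ⟨rfl, by simpa using f₄⟩
      · exact .inr (f₅ i hi h)
    obtain ⟨L, l₁, l₂, l₃⟩ := ccxLayer ((n - 1) / 2) out (fun i => u (2 * i + 2))
      (fun i => G + m + i)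
      (fun i hi j hj h => f₃ i (by omega) j (by omega) h)
      (fun i hi j hj h => by have := hu _ (by omega) _ (by omega) h; omega)
      (fun i hi j hj h => by omega)
      (fun i hi j hj => by
        have := hG (2 * j + 2) (by omega); have := hout i (by omega); omega)
      (fun i hi j hj => by have := hout i (by omega); omega)
      (fun i hi j hj => by have := hG (2 * i + 2) (by omega); omega)
    set S : Set ℕ := {w | (∃ i < n, w = u i) ∨ (G ≤ w ∧ w < G + 2 * n)} with hS
    have y₁' := y₁.mono (T := S) (by
      rintro w ⟨i, hi, rfl | rfl | rfl⟩
      · exact .inl ⟨_, by omega, rfl⟩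
      · exact .inl ⟨_, by omega, rfl⟩
      · exact .inr (by omega)) le_rfl le_rfl
    have f₁' := f₁.mono (T := S) (by
      rintro w (⟨i, hi, rfl⟩ | h)
      · exact .inr (by omega)
      · exact .inr (by omega)) le_rfl le_rfl
    have l₁' := l₁.mono (T := S) (by
      rintro w ⟨i, hi, rfl | rfl | rfl⟩
      · have := hout i (by omega)
        exact .inr (by omega)
      · exact .inl ⟨_, by omega, rfl⟩
      · exact .inr (by omega)) le_rfl le_rfl
    -- The prefix ending at an odd index consists of whole pairs, so the recursion provides it. An
    -- even positive index needs one more conjunction with `u i`, made by `L`.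
    refine ⟨L * (F * Y), fun i => if i = 0 then u 0 else
      if i % 2 = 1 then out (i / 2) else G + m + (i / 2 - 1),
      (l₁'.mul (f₁'.mul y₁')).mono subset_rfl (by omega) (by omega), ?_, ?_, rfl, ?_, ?_⟩
    · intro x w hw
      simp only [Equiv.Perm.mul_apply]
      rw [l₃ _ w (fun i hi => by omega), f₂ _ w (by omega), y₃ _ w (fun i hi => by omega)]
    · intro i hi j hj h
      dsimp only at h
      have hi' := hout (i / 2)
      have hj' := hout (j / 2)
      have h0 := hG 0
      split_ifs at h with h1 h2 h3 h4 h5 h6 h7 h8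
      · omega
      · have := hj' (by omega); have := h0 (by omega); omega
      · have := h0 (by omega); omega
      · have := hi' (by omega); have := h0 (by omega); omega
      · have := f₃ _ (by omega) _ (by omega) h; omega
      · have := hi' (by omega); omega
      · have := h0 (by omega); omega
      · have := hj' (by omega); omega
      · omega
    · intro i hi h
      dsimp only
      rw [if_neg (by omega)]
      have hi' := hout (i / 2)
      split_ifs with h1
      · have := hi' (by omega); omega
      · omega
    · intro x hx i hi
      simp only [Equiv.Perm.mul_apply]
      have hY : ∀ w, G + m ≤ w ∨ w < G → Y x w = x w := fun w hw => y₃ x w fun i hi => by omega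
      have hq : ∀ j < m, F (Y x) (out j) = andBelow (fun l => x (u l)) (2 * (j + 1)) := by
        intro j hj
        rw [f₆ (Y x) (fun w h h' => by rw [hY w (by omega)]; exact hx w (by omega) (by omega)) j hj,
          ← andBelow_pairs]
        refine andBelow_congr fun l hl => ?_
        rw [y₂ x l (by omega), hx _ (by omega) (by omega), Bool.false_xor]
      have hu0 : ∀ i < n, F (Y x) (u i) = x (u i) := by
        intro i hi
        have := hG i hi
        rw [f₂ _ _ (by omega), hY _ (by omega)]
      have hLo : ∀ z w, w < G + m ∨ G + n ≤ w → L z w = z w := fun z w hw =>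
        l₃ z w fun i hi => by omega
      by_cases h0 : i = 0
      · subst h0
        have := hG 0 hi
        rw [if_pos rfl, hLo _ _ (by omega), hu0 0 hi]
        simp [andBelow]
      rw [if_neg h0]
      by_cases h1 : i % 2 = 1
      · have := hout (i / 2) (by omega)
        rw [if_pos h1, hLo _ _ (by omega), hq _ (by omega)]
        congr 1
        omega
      · rw [if_neg h1, l₂ _ _ (by omega), hq _ (by omega), hu0 _ (by omega), f₂ _ _ (by omega),
          hY _ (by omega), hx _ (by omega) (by omega), Bool.false_xor]
        obtain ⟨j, rfl⟩ : ∃ j, i = 2 * (j + 1) := ⟨i / 2 - 1, by omega⟩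
        rw [andBelow]
        congr 3 <;> omega

end Realizes

end Subcircuits

/-! ### Carries and increments on intervals of wires -/

/-- The conjunction of the bits of `x` on the wires `lo, …, hi - 1`. -/
def allOn (x : Bits ℕ) (lo hi : ℕ) : Bool := andBelow (fun i => x (lo + i)) (hi - lo)

theorem allOn_eq_true {x : Bits ℕ} {lo hi : ℕ} :
    allOn x lo hi = true ↔ ∀ w, lo ≤ w → w < hi → x w = true := by
  rw [allOn, andBelow_eq_true]
  constructor
  · intro h w h₁ h₂
    simpa [Nat.add_sub_cancel' h₁] using h (w - lo) (by omega)
  · exact fun h l hl => h _ (by omega) (by omega)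

theorem allOn_congr {x y : Bits ℕ} {lo hi : ℕ} (h : ∀ w, lo ≤ w → w < hi → x w = y w) :
    allOn x lo hi = allOn y lo hi :=
  andBelow_congr fun l hl => h _ (by omega) (by omega)

theorem allOn_append (x : Bits ℕ) {a b c : ℕ} (hab : a ≤ b) (hbc : b ≤ c) :
    allOn x a c = (allOn x a b && allOn x b c) := by
  rw [Bool.eq_iff_iff, Bool.and_eq_true]
  simp only [allOn_eq_true]
  constructor
  · exact fun h => ⟨fun w h₁ h₂ => h w h₁ (by omega), fun w h₁ h₂ => h w (by omega) h₂⟩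
  · intro h w h₁ h₂
    rcases lt_or_ge w b with h' | h'
    · exact h.1 w h₁ h'
    · exact h.2 w h' h₂

/-- The increment of the number stored in the wires `lo, …, hi - 1` (least significant bit first),
controlled by `c`. -/
def incOn (c : Bool) (lo hi : ℕ) (x : Bits ℕ) : Bits ℕ := fun w =>
  if lo ≤ w ∧ w < hi then xor (x w) (c && allOn x lo w) else x w

/-- The complement of the increment of the number stored in the wires `lo, …, hi - 1`; all other
wires are unchanged. -/
def reflectOn (lo hi : ℕ) (x : Bits ℕ) : Bits ℕ := fun w =>
  if lo ≤ w ∧ w < hi then xor (x w) (!allOn x lo w) else x w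

/-- While the carry is alive, incrementing flips the bit and complementing flips it back, so the
conjunction is extended by the same bit; once the carry is dead, both sides stay false. -/
theorem andBelow_not_inc (c : Bool) (z : ℕ → Bool) (n : ℕ) :
    (c && andBelow (fun l => !(xor (z l) (c && andBelow z l))) n) = (c && andBelow z n) := by
  induction n with
  | zero => rfl
  | succ n ih =>
    rw [andBelow, ← Bool.and_assoc, ih, andBelow]
    cases c <;> cases andBelow z n <;> cases z n <;> rfl

/-- Complementing an incremented number restores the carries. -/
theorem allOn_not_incOn {c : Bool} {lo hi w : ℕ} {x y : Bits ℕ} (hw : w ≤ hi)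
    (hy : ∀ v, lo ≤ v → v < hi → y v = !(incOn c lo hi x v)) :
    (c && allOn y lo w) = (c && allOn x lo w) := by
  rw [allOn, allOn, ← andBelow_not_inc c (fun i => x (lo + i))]
  congr 1
  refine andBelow_congr fun l hl => ?_
  rw [hy _ (by omega) (by omega), incOn, if_pos (by omega), allOn, Nat.add_sub_cancel_left]

namespace Realizes

theorem notInterval (lo hi : ℕ) :
    ∃ F, Realizes {w | lo ≤ w ∧ w < hi} (hi - lo) 1 F ∧
      ∀ x : Bits ℕ, F x = fun w => if lo ≤ w ∧ w < hi then !(x w) else x w := by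
  obtain ⟨F, h₁, h₂, h₃⟩ := notLayer (hi - lo) (fun i => lo + i) (fun i _ j _ h => by omega)
  refine ⟨F, h₁.mono ?_ le_rfl le_rfl, fun x => ?_⟩
  · rintro w ⟨i, hi, rfl⟩
    exact ⟨by omega, by omega⟩
  · funext w
    split_ifs with h
    · obtain ⟨i, rfl⟩ := Nat.exists_eq_add_of_le h.1
      exact h₂ x i (by omega)
    · exact h₃ x w fun i hi => by omega

/-- Toggling `n` wires by the prefix conjunctions of the wires `u i`, on `2 * n` clean wires. -/
theorem prefixCopy (k n : ℕ) (hn : n ≤ 2 ^ k) (u : ℕ → ℕ) (G : ℕ)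
    (hu : ∀ i < n, ∀ j < n, u i = u j → i = j) (hG : ∀ i < n, u i < G ∨ G + 3 * n ≤ u i) :
    ∃ V : Equiv.Perm (Bits ℕ),
      Realizes {w | (∃ i < n, w = u i) ∨ (G ≤ w ∧ w < G + 3 * n)} (9 * n) (4 * k + 1) V ∧
      ∀ x, (∀ w, G ≤ w → w < G + 2 * n → x w = false) →
        V x = fun w => if G + 2 * n ≤ w ∧ w < G + 3 * n then
          xor (x w) (andBelow (fun l => x (u l)) (w - (G + 2 * n) + 1)) else x w := by
  obtain ⟨E, out, e₁, e₂, e₃, e₄, e₅, e₆⟩ := prefixTree k n hn u G hu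
    fun i hi => by have := hG i hi; omega
  have hout : ∀ i < n, (i = 0 ∧ out i = u 0) ∨ (G ≤ out i ∧ out i < G + 2 * n) := by
    intro i hi
    rcases Nat.eq_zero_or_pos i with rfl | h
    · exact .inl ⟨rfl, e₄⟩
    · exact .inr (e₅ i hi h)
  have hG0 := hG 0
  obtain ⟨C, c₁, c₂, c₃⟩ := cxLayer n out (fun i => G + 2 * n + i) e₃
    (fun i hi j hj h => by omega) (fun i hi j hj => by
      have := hout i hi; have := hG0 (by omega); omega)
  set S : Set ℕ := {w | (∃ i < n, w = u i) ∨ (G ≤ w ∧ w < G + 3 * n)} with hS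
  have e₁' := e₁.mono (T := S) (by
    rintro w (h | h)
    · exact .inl h
    · exact .inr (by omega)) le_rfl le_rfl
  have c₁' := c₁.mono (T := S) (by
    rintro w ⟨i, hi, rfl | rfl⟩
    · rcases hout i hi with h | h
      · exact .inl ⟨0, by omega, h.2⟩
      · exact .inr (by omega)
    · exact .inr (by omega)) le_rfl le_rfl
  -- Compute the prefixes, copy them to the last `n` wires, and uncompute. The copy leaves alone
  -- every wire on which `E` acts.
  refine ⟨E⁻¹ * (C * E), (e₁'.inv.mul (c₁'.mul e₁')).mono subset_rfl (by omega) (by omega),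
    fun x hx => ?_⟩
  simp only [Equiv.Perm.mul_apply]
  have hC : ∀ z w, w < G + 2 * n ∨ G + 3 * n ≤ w → C z w = z w := fun z w hw =>
    c₃ z w fun i hi => by omega
  have hmem : ∀ w ∈ {w | (∃ i < n, w = u i) ∨ (G ≤ w ∧ w < G + 2 * n)},
      w < G + 2 * n ∨ G + 3 * n ≤ w := by
    rintro w (⟨i, hi, rfl⟩ | h)
    · have := hG i hi; omega
    · omega
  refine e₁.isLocal.inv_apply (x := x) (fun w hw => hC _ w (hmem w hw)) (fun w hw => ?_)
    (fun w hw => ?_)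
  · have := hmem w hw
    rw [if_neg (by omega)]
  · split_ifs with h
    · obtain ⟨i, rfl⟩ := Nat.exists_eq_add_of_le h.1
      rw [c₂ _ i (by omega), e₆ x hx i (by omega), e₂ x _ (by omega), Nat.add_sub_cancel_left]
    · rw [hC _ w (by omega), e₁.isLocal.1 x w hw]

theorem andBelow_cons (d lo : ℕ) (x : Bits ℕ) (i : ℕ) :
    andBelow (fun l => x (if l = 0 then d else lo + (l - 1))) (i + 1) =
      (x d && allOn x lo (lo + i)) := by
  rw [Nat.add_comm i 1, andBelow_add, allOn, Nat.add_sub_cancel_left]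
  congr 1
  simp

/-- A controlled increment of `s` bits, correct if the wires `G, …, G + 3 * s - 1` hold `1`. -/
theorem incWithOnes (k s : ℕ) (hs : s ≤ 2 ^ k) (d lo G : ℕ) (hd : d < lo ∨ lo + s ≤ d)
    (hdG : d < G ∨ G + 3 * s ≤ d) (hG : lo + s ≤ G ∨ G + 3 * s ≤ lo) :
    ∃ Z : Equiv.Perm (Bits ℕ),
      Realizes {w | w = d ∨ (lo ≤ w ∧ w < lo + s) ∨ (G ≤ w ∧ w < G + 3 * s)} (27 * s) (8 * k + 7) Z ∧
      ∀ x, (∀ w, G ≤ w → w < G + 3 * s → x w = true) → Z x = incOn (x d) lo (lo + s) x := by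
  -- With the control in front, the first `i + 1` entries of `u` have as conjunction the controlled
  -- carry into bit `i`; the top bit of the interval is never an entry that is read.
  set u : ℕ → ℕ := fun l => if l = 0 then d else lo + (l - 1) with hu
  obtain ⟨V, v₁, v₂⟩ := prefixCopy k s hs u G
    (fun i hi j hj h => by simp only [hu] at h; split_ifs at h <;> omega)
    (fun i hi => by simp only [hu]; split_ifs <;> omega)
  obtain ⟨X, x₁, x₂⟩ := notInterval G (G + 3 * s)
  obtain ⟨Y, y₁, y₂⟩ := notInterval lo (lo + s)
  obtain ⟨C, c₁, c₂, c₃⟩ := cxLayer s (fun i => G + 2 * s + i) (fun i => lo + i)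
    (fun i hi j hj h => by omega) (fun i hi j hj h => by omega) (fun i hi j hj => by omega)
  set S : Set ℕ := {w | w = d ∨ (lo ≤ w ∧ w < lo + s) ∨ (G ≤ w ∧ w < G + 3 * s)} with hS
  have v₁' := v₁.mono (T := S) (by
    rintro w (⟨i, hi, rfl⟩ | h)
    · simp only [hu, hS, Set.mem_ofPred_eq]; split_ifs <;> omega
    · exact .inr (.inr h)) le_rfl le_rfl
  have x₁' := x₁.mono (T := S) (fun w h => .inr (.inr h)) le_rfl le_rfl
  have y₁' := y₁.mono (T := S) (fun w h => .inr (.inl h)) le_rfl le_rfl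
  have c₁' := c₁.mono (T := S) (by
    rintro w ⟨i, hi, rfl | rfl⟩
    · exact .inr (.inr (by omega))
    · exact .inr (.inl (by omega))) le_rfl le_rfl
  -- `X` turns the ones into clean zeros, `V` writes the carries, `C` adds them. Between the two
  -- complementations `Y`, the interval has the same carries as originally, so `V⁻¹` erases them.
  refine ⟨X * (Y * (V⁻¹ * (Y * (C * (V * X))))),
    (x₁'.mul (y₁'.mul (v₁'.inv.mul (y₁'.mul (c₁'.mul (v₁'.mul x₁')))))).mono subset_rfl
      (by omega) (by omega), fun x hx => ?_⟩
  simp only [Equiv.Perm.mul_apply]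
  set y : Bits ℕ := fun w => if G ≤ w ∧ w < G + 3 * s then false else
    if lo ≤ w ∧ w < lo + s then !(incOn (x d) lo (lo + s) x w) else x w with hy
  have hyd : y d = x d := by simp only [hy]; rw [if_neg (by omega), if_neg (by omega)]
  have hyB : ∀ w, lo ≤ w → w < lo + s → y w = !(incOn (x d) lo (lo + s) x w) := fun w h h' => by
    simp only [hy]; rw [if_neg (by omega), if_pos ⟨h, h'⟩]
  have hXw : ∀ w, G ≤ w → w < G + 3 * s → X x w = false := fun w h h' => by
    rw [x₂]; dsimp only; rw [if_pos ⟨h, h'⟩, hx w h h']; rfl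
  have hXo : ∀ w, ¬(G ≤ w ∧ w < G + 3 * s) → X x w = x w := fun w h => by
    rw [x₂]; dsimp only; rw [if_neg h]
  have key : V⁻¹ (Y (C (V (X x)))) = y := by
    rw [Equiv.Perm.inv_eq_iff_eq, v₂ y fun w h h' => by simp only [hy]; rw [if_pos (by omega)]]
    have hV := v₂ (X x) fun w h h' => hXw w h (by omega)
    funext w
    rw [y₂]
    dsimp only
    by_cases hB : lo ≤ w ∧ w < lo + s
    · rw [if_pos hB, if_neg (by omega), hyB w hB.1 hB.2, incOn, if_pos hB]
      obtain ⟨i, rfl⟩ := Nat.exists_eq_add_of_le hB.1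
      rw [c₂ _ i (by omega), hV]
      dsimp only
      rw [if_neg (by omega), if_pos (by omega), hXo _ (by omega), hXw _ (by omega) (by omega),
        Nat.add_sub_cancel_left, andBelow_cons, hXo d (by omega),
        allOn_congr (y := x) fun v h h' => hXo v (by omega), Bool.false_xor]
    · rw [if_neg hB, c₃ _ _ fun i hi => by omega, hV]
      dsimp only
      split_ifs with h
      · rw [andBelow_cons, andBelow_cons, hyd, hXo d (by omega),
          allOn_not_incOn (by omega) hyB, hXw _ (by omega) (by omega),
          allOn_congr (x := X x) (y := x) fun v h h' => hXo v (by omega)]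
        simp only [hy]
        rw [if_pos (by omega)]
      · by_cases hw : G ≤ w ∧ w < G + 3 * s
        · simp only [hy]; rw [hXw w hw.1 hw.2, if_pos hw]
        · simp only [hy]; rw [hXo w hw, if_neg hw, if_neg hB]
  rw [key]
  funext w
  rw [x₂]
  dsimp only
  rw [y₂]
  dsimp only
  by_cases hw : G ≤ w ∧ w < G + 3 * s
  · simp only [hy]
    rw [if_pos hw, if_neg (by omega), if_pos hw, incOn, if_neg (by omega), hx w hw.1 hw.2]
    rfl
  · rw [if_neg hw]
    by_cases hB : lo ≤ w ∧ w < lo + s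
    · rw [if_pos hB, hyB w hB.1 hB.2, Bool.not_not]
    · simp only [hy]
      rw [if_neg hB, if_neg hw, if_neg hB, incOn, if_neg hB]

/-- A reflection of `s` bits controlled by `c`, correct if the wires `G, …, G + 3 * s - 1` hold `1`
whenever `c` does. -/
theorem controlledReflect (k s : ℕ) (hs : s + 1 ≤ 2 ^ k) (c e lo G : ℕ) (hce : c ≠ e)
    (hc : c < lo ∨ lo + s ≤ c) (hcG : c < G ∨ G + 3 * s ≤ c) (he : e < lo ∨ lo + s ≤ e)
    (heG : e < G ∨ G + 3 * s ≤ e) (hG : lo + s ≤ G ∨ G + 3 * s ≤ lo) :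
    ∃ F : Equiv.Perm (Bits ℕ),
      Realizes {w | w = c ∨ w = e ∨ (lo ≤ w ∧ w < lo + s) ∨ (G ≤ w ∧ w < G + 3 * s)}
        (56 * s + 3) (18 * k + 16) F ∧
      (∀ x, x c = false → F x = x) ∧
      ∀ x, x c = true → (∀ w, G ≤ w → w < G + 3 * s → x w = true) →
        F x = reflectOn lo (lo + s) x := by
  obtain ⟨Z, z₁, z₂⟩ := incWithOnes k s (by omega) e lo G he heG hG
  set u : ℕ → ℕ := fun l => if l = 0 then e else lo + (l - 1) with hu
  have hu0 : u 0 = e := rfl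
  have hus : ∀ i, u (i + 1) = lo + i := fun i => rfl
  obtain ⟨M, m₁, m₂, m₃⟩ := fanOut k (s + 1) hs c u
    (fun i hi j hj h => by simp only [hu] at h; split_ifs at h <;> omega)
    (fun i hi => by simp only [hu]; split_ifs <;> omega)
  set S : Set ℕ := {w | w = c ∨ w = e ∨ (lo ≤ w ∧ w < lo + s) ∨ (G ≤ w ∧ w < G + 3 * s)} with hS
  have z₁' := z₁.mono (T := S) (fun w h => .inr h) le_rfl le_rfl
  have m₁' := m₁.mono (T := S) (by
    rintro w (rfl | ⟨i, hi, rfl⟩)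
    · exact .inl rfl
    · simp only [hu, hS, Set.mem_ofPred_eq]; split_ifs <;> omega) le_rfl le_rfl
  have d₁ : Realizes S 1 1 (Gate.CX c e hce).perm := gate _ (by
    intro w hw
    simp only [Gate.support, Finset.coe_insert, Finset.coe_singleton, Set.mem_insert_iff,
      Set.mem_singleton_iff] at hw
    rcases hw with rfl | rfl
    · exact .inl rfl
    · exact .inr (.inl rfl))
  have hM : ∀ x, M x = fun w => if w = e ∨ (lo ≤ w ∧ w < lo + s) then xor (x w) (x c) else x w := by
    intro x
    funext w
    split_ifs with h
    · rcases h with rfl | h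
      · rw [← hu0, m₂ x 0 (by omega)]
      · obtain ⟨i, rfl⟩ := Nat.exists_eq_add_of_le h.1
        rw [← hus, m₂ x _ (by omega)]
    · exact m₃ x w fun i hi => by simp only [hu]; split_ifs <;> omega
  have hZc : ∀ x, Z x c = x c := fun x => z₁.isLocal.1 x c (by
    simp only [Set.mem_ofPred_eq]; omega)
  -- With the control on, x becomes x + e, then its complement, and then 1 - e is subtracted because
  -- `M` also flips `e`. The result is the complement of x + 1; the final gate restores `e`. With
  -- the control off, `Z` cancels even if its workspace is arbitrary.
  refine ⟨(Gate.CX c e hce).perm * (Z⁻¹ * (M * Z)),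
    (d₁.mul (z₁'.inv.mul (m₁'.mul z₁'))).mono subset_rfl (by omega) (by omega), ?_, ?_⟩
  · intro x hx
    simp only [Equiv.Perm.mul_apply]
    have : M (Z x) = Z x := by
      rw [hM, hZc, hx]; simp
    rw [this]
    simp [Gate.act, hx]
  · intro x hx hones
    simp only [Equiv.Perm.mul_apply]
    set y : Bits ℕ := fun w => if w = e then !(x e) else reflectOn lo (lo + s) x w with hy
    have hye : y e = !(x e) := by simp [hy]
    have hyw : ∀ w, w ≠ e → y w = reflectOn lo (lo + s) x w := fun w hw => by simp [hy, hw]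
    have key : Z⁻¹ (M (Z x)) = y := by
      rw [Equiv.Perm.inv_eq_iff_eq, hM, hZc, z₂ x hones, z₂ y fun w h h' => by
        rw [hyw w (by omega), reflectOn, if_neg (by omega), hones w h h'], hye, hx]
      -- The reflected interval is a complemented increment, hence has the carries of `x`.
      have hyB : ∀ v, lo ≤ v → v < lo + s → y v = !(incOn true lo (lo + s) x v) := by
        intro v h h'
        rw [hyw v (by omega), reflectOn, incOn, if_pos ⟨h, h'⟩, if_pos ⟨h, h'⟩]
        cases x v <;> cases allOn x lo v <;> rfl
      funext w
      by_cases hB : lo ≤ w ∧ w < lo + s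
      · have h1 := allOn_not_incOn (c := true) (w := w) (by omega) hyB
        rw [if_pos (.inr hB)]
        rw [Bool.true_and, Bool.true_and] at h1
        conv_rhs => rw [incOn, if_pos hB, hyB w hB.1 hB.2, h1, incOn, if_pos hB]
        rw [incOn, if_pos hB]
        cases x e <;> cases x w <;> cases allOn x lo w <;> rfl
      · by_cases hwe : w = e
        · subst hwe
          rw [if_pos (.inl rfl), incOn, incOn, if_neg hB, if_neg hB, hye]
          simp
        · rw [if_neg (by tauto), incOn, if_neg hB, incOn, if_neg hB, hyw w hwe, reflectOn,
            if_neg hB]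
    rw [key]
    funext w
    rw [Gate.perm_apply, Gate.act]
    by_cases hwe : w = e
    · subst hwe
      rw [Function.update_self, hye, hyw c hce, reflectOn, if_neg (by omega), hx, reflectOn,
        if_neg (by omega)]
      simp
    · rw [Function.update_of_ne hwe, hyw w hwe]

end Realizes

/-! ### Division into blocks -/

/-- A division of the wires `2 * t + 32, …, N - 1` into the `t` blocks `o j, …, o (j + 1) - 1` such
that the free wires needed to process a block can be found below it, and are different from those
needed for a block at distance `9`. -/
structure BlockLayout (t k N : ℕ) (o : ℕ → ℕ) : Prop where
  zero : o 0 = 2 * t + 32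
  last : o t = N
  lt : ∀ j < t, o j < o (j + 1)
  space : ∀ j < t, 2 * t + (3 * (o (j + 1) - o j) + 1) ≤ o j
  sep : ∀ i j, j < t → i + 9 ≤ j → o (i + 1) + (3 * (o (j + 1) - o j) + 1) ≤ o j
  size : ∀ j < t, o (j + 1) - o j + 1 ≤ 2 ^ k

namespace BlockLayout

variable {t k N : ℕ} {o : ℕ → ℕ}

theorem mono (h : BlockLayout t k N o) {i j : ℕ} (hij : i ≤ j) (hj : j ≤ t) : o i ≤ o j := by
  induction j with
  | zero => simp_all
  | succ j ih =>
    rcases Nat.lt_or_ge i (j + 1) with h' | h'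
    · exact (ih (by omega) (by omega)).trans (h.lt j (by omega)).le
    · rw [show i = j + 1 by omega]

theorem le (h : BlockLayout t k N o) : 2 * t + 32 ≤ N := by
  rw [← h.zero, ← h.last]; exact h.mono (Nat.zero_le _) le_rfl

theorem bounds (h : BlockLayout t k N o) {j : ℕ} (hj : j < t) :
    2 * t + 32 ≤ o j ∧ o j < o (j + 1) ∧ o (j + 1) ≤ N :=
  ⟨h.zero ▸ h.mono (Nat.zero_le _) hj.le, h.lt j hj, h.last ▸ h.mono hj le_rfl⟩

theorem unique (h : BlockLayout t k N o) {i j w : ℕ} (hi : i < t) (hj : j < t)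
    (h₁ : o i ≤ w) (h₂ : w < o (i + 1)) (h₃ : o j ≤ w) (h₄ : w < o (j + 1)) : i = j := by
  by_contra hne
  rcases lt_or_gt_of_ne hne with h' | h'
  · have := h.mono (i := i + 1) (j := j) h' hj.le
    omega
  · have := h.mono (i := j + 1) (j := i) h' hi.le
    omega

theorem exists_block (h : BlockLayout t k N o) {w : ℕ} (h₁ : 2 * t + 32 ≤ w) (h₂ : w < N) :
    ∃ j < t, o j ≤ w ∧ w < o (j + 1) := by
  have : ∀ n ≤ t, w < o n → ∃ j < t, o j ≤ w ∧ w < o (j + 1) := by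
    intro n
    induction n with
    | zero => intro _ h'; rw [h.zero] at h'; omega
    | succ n ih =>
      intro hn hw
      rcases lt_or_ge w (o n) with h' | h'
      · exact ih (by omega) h'
      · exact ⟨n, by omega, h', hw⟩
  exact this t le_rfl (h.last ▸ h₂)

theorem sum_size (h : BlockLayout t k N o) :
    ∑ j ∈ Finset.range t, (o (j + 1) - o j) + (2 * t + 32) = N := by
  have : ∀ n ≤ t, ∑ j ∈ Finset.range n, (o (j + 1) - o j) + (2 * t + 32) = o n := by
    intro n
    induction n with
    | zero => intro _; simp [h.zero]
    | succ n ih =>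
      intro hn
      have := ih (by omega)
      have := h.lt n (by omega)
      rw [Finset.sum_range_succ]
      omega
  rw [this t le_rfl, h.last]

theorem sum_le (h : BlockLayout t k N o) (a b : ℕ) :
    ∑ j ∈ Finset.range t, (a * (o (j + 1) - o j) + b) ≤ a * N + b * t := by
  rw [Finset.sum_add_distrib, ← Finset.mul_sum, Finset.sum_const, Finset.card_range, smul_eq_mul,
    mul_comm t b]
  have := h.sum_size
  exact Nat.add_le_add_right (Nat.mul_le_mul_left a (by omega)) _

end BlockLayout

/-- The wire that holds the carry into block `j`. -/
def carryWire (t d j : ℕ) : ℕ := if j = 0 then d else t + j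

/-! ### Incrementing all blocks when the low wires hold ones -/

namespace Realizes

/-- Toggling the wire `v` by the conjunction of `s` bits, provided that the wires
`G, …, G + 2 * s - 1` hold `1`; the other wires are restored in any case. -/
theorem toggleAll (k s : ℕ) (hs : s ≤ 2 ^ k) (hs0 : 0 < s) (v lo G : ℕ)
    (hv : v < lo ∨ lo + s ≤ v) (hvG : v < G ∨ G + 2 * s ≤ v)
    (hG : lo + s ≤ G ∨ G + 2 * s ≤ lo) :
    ∃ (F : Equiv.Perm (Bits ℕ)) (h : Bits ℕ → Bool),
      Realizes {w | w = v ∨ (lo ≤ w ∧ w < lo + s) ∨ (G ≤ w ∧ w < G + 2 * s)}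
        (12 * s + 1) (4 * k + 3) F ∧
      (∀ x y : Bits ℕ, (∀ w, (lo ≤ w ∧ w < lo + s) ∨ (G ≤ w ∧ w < G + 2 * s) → x w = y w) →
        h x = h y) ∧
      (∀ x, F x = fun w => if w = v then xor (x w) (h x) else x w) ∧
      ∀ x, (∀ w, G ≤ w → w < G + 2 * s → x w = true) → h x = allOn x lo (lo + s) := by
  obtain ⟨E, out, e₁, e₂, -, e₄, e₅, e₆⟩ := prefixTree k s hs (fun i => lo + i) G
    (fun i hi j hj h => by omega) (fun i hi => by omega)
  obtain ⟨X, x₁, x₂⟩ := notInterval G (G + 2 * s)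
  have hr : out (s - 1) = lo ∨ (G ≤ out (s - 1) ∧ out (s - 1) < G + 2 * s) := by
    rcases Nat.eq_zero_or_pos (s - 1) with h | h
    · rw [h]; exact .inl e₄
    · exact .inr (e₅ _ (by omega) h)
  set r := out (s - 1) with hr'
  have hrv : r ≠ v := by omega
  set S : Set ℕ := {w | w = v ∨ (lo ≤ w ∧ w < lo + s) ∨ (G ≤ w ∧ w < G + 2 * s)} with hS
  set T : Set ℕ := {w | (lo ≤ w ∧ w < lo + s) ∨ (G ≤ w ∧ w < G + 2 * s)} with hT
  have e₁' := e₁.mono (T := T) (by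
    rintro w (⟨i, hi, rfl⟩ | h)
    · exact .inl (by omega)
    · exact .inr h) le_rfl le_rfl
  have x₁' := x₁.mono (T := T) (fun w h => .inr h) le_rfl le_rfl
  have hTS : T ⊆ S := fun w h => .inr h
  have d₁ : Realizes S 1 1 (Gate.CX r v hrv).perm := gate _ (by
    intro w hw
    simp only [Gate.support, Finset.coe_insert, Finset.coe_singleton, Set.mem_insert_iff,
      Set.mem_singleton_iff] at hw
    simp only [hS, Set.mem_ofPred_eq]
    omega)
  have k₁ := e₁'.mul x₁'
  have k₁' := k₁.mono hTS le_rfl le_rfl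
  have hloc : ∀ x y : Bits ℕ, (∀ w, (lo ≤ w ∧ w < lo + s) ∨ (G ≤ w ∧ w < G + 2 * s) →
      x w = y w) → (E * X) x r = (E * X) y r := by
    intro x y hxy
    exact k₁.isLocal.2 x y hxy r (by simp only [hT, Set.mem_ofPred_eq]; omega)
  -- The wire `v` lies outside the support of `E * X`, so the conjugation restores all workspace
  -- whatever it held. The toggle is the bit found on `r`, which is the conjunction only if the
  -- workspace held ones.
  refine ⟨(E * X)⁻¹ * ((Gate.CX r v hrv).perm * (E * X)), fun x => (E * X) x r,
    (k₁'.inv.mul (d₁.mul k₁')).mono subset_rfl (by omega) (by omega), hloc, ?_, ?_⟩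
  · intro x
    rw [Equiv.Perm.mul_apply, Equiv.Perm.mul_apply _ (E * X)]
    have hvT : v ∉ T := by simp only [hT, Set.mem_ofPred_eq]; omega
    refine k₁.isLocal.inv_apply (x := x) (fun w hw => ?_) (fun w hw => ?_) fun w hw => ?_
    · have : w ≠ v := by rintro rfl; exact hvT hw
      simp [Gate.act, this]
    · have : w ≠ v := by rintro rfl; exact hvT hw
      rw [if_neg this]
    · rw [Gate.perm_apply, Gate.act]
      split_ifs with h
      · rw [h, Function.update_self, k₁.isLocal.1 x v hvT]
      · rw [Function.update_of_ne h, k₁.isLocal.1 x w hw]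
  · intro x hx
    change E (X x) r = _
    rw [e₆ (X x) (fun w h h' => by rw [x₂]; dsimp only; rw [if_pos ⟨h, h'⟩, hx w h h']; rfl)
      (s - 1) (by omega), allOn, Nat.add_sub_cancel_left, Nat.sub_add_cancel hs0]
    refine andBelow_congr fun l hl => ?_
    rw [x₂]
    dsimp only
    rw [if_neg (by omega)]

variable {t k N d : ℕ} {o : ℕ → ℕ}

/-- Toggling a flag for every block; the flag of block `j` is right if the free wires of block `j`
hold `1`. -/
theorem toggleFlags (h : BlockLayout t k N o) :
    ∃ (F : Equiv.Perm (Bits ℕ)) (f : ℕ → Bits ℕ → Bool),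
      Realizes {w | w < t ∨ (2 * t ≤ w ∧ w < N)} (12 * N + t) (9 * (4 * k + 3)) F ∧
      (∀ x, F x = fun w => if w < t then xor (x w) (f w x) else x w) ∧
      ∀ x, ∀ j < t, (∀ w, 2 * t ≤ w → w < o j → x w = true) →
        f j x = allOn x (o j) (o (j + 1)) := by
  have hex : ∀ j, ∃ (F : Equiv.Perm (Bits ℕ)) (f : Bits ℕ → Bool), j < t →
      Realizes {w | w = j ∨ (o j ≤ w ∧ w < o (j + 1)) ∨
        (o j - (3 * (o (j + 1) - o j) + 1) ≤ w ∧ w < o j)}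
        (12 * (o (j + 1) - o j) + 1) (4 * k + 3) F ∧
      (∀ x y : Bits ℕ, (∀ w, 2 * t ≤ w → w < N → x w = y w) → f x = f y) ∧
      (∀ x, F x = fun w => if w = j then xor (x w) (f x) else x w) ∧
      ∀ x, (∀ w, 2 * t ≤ w → w < o j → x w = true) → f x = allOn x (o j) (o (j + 1)) := by
    intro j
    by_cases hj : j < t
    swap
    · exact ⟨1, fun _ => true, fun h => absurd h hj⟩
    have hb := h.bounds hj
    have hsp := h.space j hj
    have hsz := h.size j hj
    set s := o (j + 1) - o j with hs
    obtain ⟨F, f, f₁, f₂, f₃, f₄⟩ := toggleAll k s (by omega) (by omega) j (o j)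
      (o j - (3 * s + 1)) (by omega) (by omega) (by omega)
    refine ⟨F, f, fun _ => ⟨f₁.mono ?_ le_rfl le_rfl, ?_, f₃, ?_⟩⟩
    · intro w hw
      simp only [Set.mem_ofPred_eq] at hw ⊢
      omega
    · exact fun x y hxy => f₂ x y fun w hw => hxy w (by omega) (by omega)
    · intro x hx
      rw [f₄ x fun w h h' => hx w (by omega) (by omega)]
      congr 1
      omega
  choose F f hF using hex
  -- Distinct indices congruent modulo 9 differ by at least 9, which is the distance covered by
  -- `BlockLayout.sep`.
  obtain ⟨Φ, p₁, p₂⟩ := rounds 9 t (by norm_num) (f := F) (fun j hj => (hF j hj).1) (by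
    intro i hi j hj hij hmod
    have hs := h.sep i j hj (by omega)
    have hspi := h.space i hi
    have hspj := h.space j hj
    clear hmod
    have hbi := h.bounds hi
    have hbj := h.bounds hj
    rw [Set.disjoint_left]
    intro w hw hw'
    simp only [Set.mem_ofPred_eq] at hw hw'
    omega)
  refine ⟨Φ, f, p₁.mono ?_ ((h.sum_le 12 1).trans (by omega)) le_rfl, fun x => ?_,
    fun x j hj => (hF j hj).2.2.2 x⟩
  · intro w hw
    simp only [Finset.mem_range, Set.mem_iUnion, Set.mem_ofPred_eq, exists_prop] at hw ⊢
    obtain ⟨j, hj, hw⟩ := hw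
    have := h.bounds hj
    have := h.space j hj
    omega
  -- The toggles read only wires from `2 * t` on, so setting some flags does not affect the others.
  · have := p₂ (fun K w => if w < t ∧ w ∈ K then xor (x w) (f w x) else x w) (by
      intro K j hj hjK
      rw [(hF j hj).2.2.1]
      funext w
      rw [(hF j hj).2.1 (fun w => if w < t ∧ w ∈ K then xor (x w) (f w x) else x w) x
        fun w h₁ _ => if_neg (by omega)]
      by_cases hw : w = j
      · subst hw
        simp [hjK, hj]
      · simp [hw])
    simpa using this

/-- The conjunctions of the first flags, for clean carry wires. -/
theorem chainCarries (hd : 2 * t ≤ d) (n : ℕ) (hn : n < t) :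
    ∃ F : Equiv.Perm (Bits ℕ), Realizes {w | w = d ∨ w < 2 * t} n n F ∧
      ∀ x, (∀ w, t < w → w ≤ t + n → x w = false) →
        F x = fun w => if t < w ∧ w ≤ t + n then x d && andBelow x (w - t) else x w := by
  induction n with
  | zero =>
    refine ⟨1, .one _ _ _, fun x _ => ?_⟩
    funext w
    rw [if_neg (by omega)]
    rfl
  | succ n ih =>
    obtain ⟨F, f₁, f₂⟩ := ih (by omega)
    have g₁ : carryWire t d n ≠ n := by rw [carryWire]; split_ifs <;> omega
    have g₂ : carryWire t d n ≠ t + (n + 1) := by rw [carryWire]; split_ifs <;> omega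
    have g₃ : n ≠ t + (n + 1) := by omega
    refine ⟨(Gate.CCX _ _ _ g₁ g₂ g₃).perm * F, ((gate _ (S := {w | w = d ∨ w < 2 * t}) ?_).mul
      f₁).mono subset_rfl (by omega) (by omega), fun x hx => ?_⟩
    · intro w hw
      simp only [Gate.support, Finset.coe_insert, Finset.coe_singleton, Set.mem_insert_iff,
        Set.mem_singleton_iff, carryWire] at hw
      simp only [Set.mem_ofPred_eq]
      split_ifs at hw <;> omega
    · rw [Equiv.Perm.mul_apply, f₂ x fun w h h' => hx w h (by omega), Gate.perm_apply, Gate.act]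
      funext w
      by_cases hw : w = t + (n + 1)
      · have hcw : (if t < carryWire t d n ∧ carryWire t d n ≤ t + n then
            x d && andBelow x (carryWire t d n - t) else x (carryWire t d n)) =
            (x d && andBelow x n) := by
          rcases Nat.eq_zero_or_pos n with rfl | h
          · rw [if_neg (by omega)]; simp [carryWire, andBelow]
          · have : carryWire t d n = t + n := if_neg (by omega)
            rw [this, if_pos (by omega), Nat.add_sub_cancel_left]
        subst hw
        rw [Function.update_self, hcw, if_neg (by omega), hx _ (by omega) (by omega),
          if_neg (by omega), if_pos (by omega), Bool.false_xor, Nat.add_sub_cancel_left, andBelow,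
          ← Bool.and_assoc]
      · rw [Function.update_of_ne hw]
        by_cases h : t < w ∧ w ≤ t + n
        · rw [if_pos h, if_pos (by omega)]
        · rw [if_neg h, if_neg (by omega)]

/-- Computing the carries into all blocks, given clean wires. -/
theorem carries (h : BlockLayout t k N o) (hd : N ≤ d) :
    ∃ F : Equiv.Perm (Bits ℕ),
      Realizes {w | w = d ∨ w < N} (24 * N + 3 * t) (72 * k + 54 + t) F ∧
      ∀ x, (∀ w < 2 * t, x w = false) → (∀ w, 2 * t ≤ w → w < 2 * t + 32 → x w = true) →
        F x = fun w => if t < w ∧ w < 2 * t then x d && allOn x (2 * t + 32) (o (w - t))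
          else x w := by
  have hN := h.le
  rcases Nat.eq_zero_or_pos t with rfl | ht
  · refine ⟨1, .one _ _ _, fun x _ _ => ?_⟩
    funext w
    rw [if_neg (by omega)]
    rfl
  obtain ⟨F, f, f₁, f₂, f₃⟩ := toggleFlags h
  obtain ⟨C, c₁, c₂⟩ := chainCarries (t := t) (d := d) (by omega) (t - 1) (by omega)
  have f₁' := f₁.mono (T := {w | w = d ∨ w < N}) (by
    intro w hw; simp only [Set.mem_ofPred_eq] at hw ⊢; omega) le_rfl le_rfl
  have c₁' := c₁.mono (T := {w | w = d ∨ w < N}) (by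
    intro w hw; simp only [Set.mem_ofPred_eq] at hw ⊢; omega) le_rfl le_rfl
  refine ⟨F⁻¹ * (C * F), (f₁'.inv.mul (c₁'.mul f₁')).mono subset_rfl (by omega) (by omega),
    fun x hx hx' => ?_⟩
  simp only [Equiv.Perm.mul_apply]
  have hF : ∀ w, t ≤ w → F x w = x w := fun w hw => by
    rw [f₂]; dsimp only; rw [if_neg (by omega)]
  have hC := c₂ (F x) fun w h₁ h₂ => by rw [hF w h₁.le, hx w (by omega)]
  -- A flag may be wrong only when some wire below its block, or the control, fails to hold 1. If
  -- `d` or a bit in a lower block is 0, the conjunction is already false there; otherwise the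
  -- workspace holds ones and the flag is right.
  have key : ∀ j ≤ t, (x d && andBelow (F x) j) = (x d && allOn x (2 * t + 32) (o j)) := by
    intro j
    induction j with
    | zero => intro _; simp [h.zero, allOn, andBelow]
    | succ j ih =>
      intro hj
      have hb := h.bounds (j := j) (by omega)
      rw [andBelow, ← Bool.and_assoc, ih (by omega),
        allOn_append x hb.1 hb.2.1.le, ← Bool.and_assoc]
      rcases Bool.eq_false_or_eq_true (x d && allOn x (2 * t + 32) (o j)) with h₁ | h₁
      · congr 1
        rw [f₂]
        dsimp only
        rw [if_pos (by omega), hx j (by omega), Bool.false_xor]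
        refine f₃ x j (by omega) fun w h₂ h₃ => ?_
        rw [Bool.and_eq_true, allOn_eq_true] at h₁
        rcases lt_or_ge w (2 * t + 32) with h' | h'
        · exact hx' w h₂ h'
        · exact h₁.2 w h' h₃
      · rw [h₁]; rfl
  refine f₁.isLocal.inv_apply (x := x) (fun w hw => ?_) (fun w hw => ?_) fun w hw => ?_
  · simp only [Set.mem_ofPred_eq] at hw
    rw [hC]
    dsimp only
    rw [if_neg (by omega)]
  · simp only [Set.mem_ofPred_eq] at hw
    rw [if_neg (by omega)]
  · simp only [Set.mem_ofPred_eq] at hw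
    rw [hC]
    dsimp only
    rw [hF d (by omega)]
    by_cases h' : t < w ∧ w < 2 * t
    · rw [if_pos h', if_pos (by omega), key _ (by omega)]
    · rw [if_neg h', if_neg (by omega), hF w (by omega)]

/-- Reflecting all blocks into which there is a carry. -/
theorem reflectBlocks (h : BlockLayout t k N o) (hd : N ≤ d) :
    ∃ F : Equiv.Perm (Bits ℕ),
      Realizes {w | w = d ∨ w < N} (56 * N + 3 * t) (9 * (18 * k + 16)) F ∧
      ∀ x : Bits ℕ, (∀ j < t, x (carryWire t d j) = true →
          ∀ w, 2 * t ≤ w → w < o j → x w = true) →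
        (∀ j < t, ∀ w, o j ≤ w → w < o (j + 1) →
          F x w = xor (x w) (x (carryWire t d j) && !allOn x (o j) w)) ∧
        ∀ w, w < 2 * t + 32 ∨ N ≤ w → F x w = x w := by
  have hex : ∀ j, ∃ F : Equiv.Perm (Bits ℕ), j < t →
      Realizes {w | w = carryWire t d j ∨
        (o j - (3 * (o (j + 1) - o j) + 1) ≤ w ∧ w < o (j + 1))}
        (56 * (o (j + 1) - o j) + 3) (18 * k + 16) F ∧
      (∀ x, x (carryWire t d j) = false → F x = x) ∧
      ∀ x, x (carryWire t d j) = true → (∀ w, 2 * t ≤ w → w < o j → x w = true) →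
        F x = reflectOn (o j) (o (j + 1)) x := by
    intro j
    by_cases hj : j < t
    swap
    · exact ⟨1, fun h => absurd h hj⟩
    have hb := h.bounds hj
    have hsp := h.space j hj
    have hsz := h.size j hj
    set s := o (j + 1) - o j with hs
    have hc : carryWire t d j < 2 * t ∨ N ≤ carryWire t d j := by
      rw [carryWire]; split_ifs <;> omega
    -- Of the `3 * s + 1` wires below the block, the topmost serves as the auxiliary bit `e`, the
    -- others as workspace.
    obtain ⟨F, f₁, f₂, f₃⟩ := controlledReflect k s hsz (carryWire t d j) (o j - 1) (o j)
      (o j - (3 * s + 1)) (by omega) (by omega) (by omega) (by omega) (by omega) (by omega)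
    refine ⟨F, fun _ => ⟨f₁.mono ?_ le_rfl le_rfl, f₂, ?_⟩⟩
    · intro w hw
      simp only [Set.mem_ofPred_eq] at hw ⊢
      omega
    · intro x hx hx'
      rw [f₃ x hx fun w h h' => hx' w (by omega) (by omega)]
      congr 1
      omega
  choose F hF using hex
  obtain ⟨Φ, p₁, p₂⟩ := rounds 9 t (by norm_num) (f := F) (fun j hj => (hF j hj).1) (by
    intro i hi j hj hij hmod
    have hs := h.sep i j hj (by omega)
    have hspi := h.space i hi
    have hspj := h.space j hj
    clear hmod
    have hbi := h.bounds hi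
    have hbj := h.bounds hj
    rw [Set.disjoint_left]
    intro w hw hw'
    simp only [Set.mem_ofPred_eq, carryWire] at hw hw'
    split_ifs at hw hw' <;> omega)
  refine ⟨Φ, p₁.mono ?_ (h.sum_le 56 3) le_rfl, fun x hx => ?_⟩
  · intro w hw
    simp only [Finset.mem_range, Set.mem_iUnion, Set.mem_ofPred_eq, exists_prop, carryWire] at hw ⊢
    obtain ⟨j, hj, hw⟩ := hw
    have := h.bounds hj
    have := h.le
    split_ifs at hw <;> omega
  · classical
    -- The state after exactly the blocks in `K` have been handled, in terms of the initial `x`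
    -- only.
    set st : Finset ℕ → Bits ℕ := fun K w =>
      if ∃ j ∈ K, j < t ∧ o j ≤ w ∧ w < o (j + 1) ∧ x (carryWire t d j) = true ∧
        allOn x (o j) w = false then !(x w) else x w with hst
    have hstj : ∀ K w j, j < t → o j ≤ w → w < o (j + 1) →
        st K w = if j ∈ K then xor (x w) (x (carryWire t d j) && !allOn x (o j) w) else x w := by
      intro K w j hj h₁ h₂
      simp only [hst]
      split_ifs with h₃ h₄ h₄
      · obtain ⟨i, hi, hit, h₅, h₆, h₇, h₈⟩ := h₃
        obtain rfl := h.unique hit hj h₅ h₆ h₁ h₂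
        simp [h₇, h₈]
      · obtain ⟨i, hi, hit, h₅, h₆, h₇, h₈⟩ := h₃
        obtain rfl := h.unique hit hj h₅ h₆ h₁ h₂
        exact absurd hi h₄
      · have : (x (carryWire t d j) && !allOn x (o j) w) = false := by
          by_contra hne
          simp only [Bool.not_eq_false, Bool.and_eq_true, Bool.not_eq_true'] at hne
          exact h₃ ⟨j, h₄, hj, h₁, h₂, hne.1, hne.2⟩
        rw [this, Bool.xor_false]
      · rfl
    have hsto : ∀ K w, w < 2 * t + 32 ∨ N ≤ w → st K w = x w := by
      intro K w hw
      simp only [hst]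
      rw [if_neg]
      rintro ⟨j, -, hj, h₁, h₂, -⟩
      have := h.bounds hj
      omega
    have hcw : ∀ j < t, carryWire t d j < 2 * t + 32 ∨ N ≤ carryWire t d j := by
      intro j hj; rw [carryWire]; split_ifs <;> omega
    have := p₂ st (by
      intro K j hj hjK
      have hc : st K (carryWire t d j) = x (carryWire t d j) := hsto K _ (hcw j hj)
      have hsplit : ∀ w, (∃ i < t, o i ≤ w ∧ w < o (i + 1)) ∨ (w < 2 * t + 32 ∨ N ≤ w) := by
        intro w
        by_cases hw : w < 2 * t + 32 ∨ N ≤ w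
        · exact .inr hw
        · exact .inl (h.exists_block (by omega) (by omega))
      rcases Bool.eq_false_or_eq_true (x (carryWire t d j)) with h₁ | h₁
      -- A carry into block `j` means ones in all lower blocks. Reflection fixes a block of ones, so
      -- they are still there whichever blocks have been handled.
      · have hlow : ∀ w, 2 * t ≤ w → w < o j → st K w = true := by
          intro w h₂ h₃
          rcases hsplit w with ⟨i, hi, h₄, h₅⟩ | h₄
          · have hall : allOn x (o i) w = true := allOn_eq_true.2 fun v h₆ h₇ =>
              hx j hj h₁ v (by have := h.bounds hi; omega) (by omega)
            rw [hstj K w i hi h₄ h₅, hall, hx j hj h₁ w h₂ h₃]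
            simp
          · rw [hsto K w h₄, hx j hj h₁ w h₂ h₃]
        rw [(hF j hj).2.2 _ (hc.trans h₁) hlow]
        funext w
        rw [reflectOn]
        rcases hsplit w with ⟨i, hi, h₄, h₅⟩ | h₄
        · by_cases hij : i = j
          · subst hij
            rw [if_pos ⟨h₄, h₅⟩, hstj _ w i hi h₄ h₅, hstj _ w i hi h₄ h₅, if_neg hjK,
              if_pos (by simp), h₁, Bool.true_and, allOn_congr (y := x) fun v h₆ h₇ => by
                rw [hstj K v i hi h₆ (by omega), if_neg hjK]]
          · rw [if_neg fun h' => hij (h.unique hi hj h₄ h₅ h'.1 h'.2), hstj _ w i hi h₄ h₅,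
              hstj _ w i hi h₄ h₅]
            simp [hij]
        · have := h.bounds hj
          rw [if_neg (by omega), hsto _ w h₄, hsto _ w h₄]
      · rw [(hF j hj).2.1 _ (hc.trans h₁)]
        funext w
        rcases hsplit w with ⟨i, hi, h₄, h₅⟩ | h₄
        · rw [hstj _ w i hi h₄ h₅, hstj _ w i hi h₄ h₅]
          by_cases hij : i = j
          · subst hij
            simp [h₁]
          · simp [hij]
        · rw [hsto _ w h₄, hsto _ w h₄])
    have h0 : st ∅ = x := by funext w; simp [hst]
    rw [h0] at this
    refine ⟨fun j hj w h₁ h₂ => ?_, fun w hw => ?_⟩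
    · rw [this, hstj _ w j hj h₁ h₂, if_pos (by simpa using hj)]
    · rw [this, hsto _ w hw]

/-- Complementing all blocks into which there is a carry. -/
theorem complementBlocks (h : BlockLayout t k N o) (hd : N ≤ d) :
    ∃ F : Equiv.Perm (Bits ℕ),
      Realizes {w | w = d ∨ w < N} (2 * N) (2 * k + 1) F ∧
      ∀ x : Bits ℕ, (∀ j < t, ∀ w, o j ≤ w → w < o (j + 1) →
          F x w = xor (x w) (x (carryWire t d j))) ∧
        ∀ w, w < 2 * t + 32 ∨ N ≤ w → F x w = x w := by
  have hex : ∀ j, ∃ F : Equiv.Perm (Bits ℕ), j < t →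
      Realizes {w | w = carryWire t d j ∨ (o j ≤ w ∧ w < o (j + 1))}
        (2 * (o (j + 1) - o j) + 0) (2 * k + 1) F ∧
      (∀ x w, o j ≤ w → w < o (j + 1) → F x w = xor (x w) (x (carryWire t d j))) ∧
      ∀ x w, ¬(o j ≤ w ∧ w < o (j + 1)) → F x w = x w := by
    intro j
    by_cases hj : j < t
    swap
    · exact ⟨1, fun h => absurd h hj⟩
    have hb := h.bounds hj
    have hsz := h.size j hj
    have hc : carryWire t d j < 2 * t ∨ N ≤ carryWire t d j := by
      rw [carryWire]; split_ifs <;> omega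
    obtain ⟨F, f₁, f₂, f₃⟩ := fanOut k (o (j + 1) - o j) (by omega) (carryWire t d j)
      (fun i => o j + i) (fun i hi i' hi' h => by omega) (fun i hi => by omega)
    refine ⟨F, fun _ => ⟨f₁.mono ?_ (by omega) le_rfl, ?_, ?_⟩⟩
    · rintro w (rfl | ⟨i, hi, rfl⟩)
      · exact .inl rfl
      · exact .inr (by omega)
    · intro x w h₁ h₂
      obtain ⟨i, rfl⟩ := Nat.exists_eq_add_of_le h₁
      exact f₂ x i (by omega)
    · exact fun x w hw => f₃ x w fun i hi => by omega
  choose F hF using hex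
  -- No workspace is needed: the blocks with their carry wires are pairwise disjoint, and one round
  -- suffices.
  obtain ⟨Φ, p₁, p₂, -⟩ := family (Finset.range t) (f := F)
    (fun j hj => (hF j (Finset.mem_range.1 hj)).1) (by
    intro i hi j hj hij
    rw [Finset.mem_range] at hi hj
    have hbi := h.bounds hi
    have hbj := h.bounds hj
    rw [Set.disjoint_left]
    intro w hw hw'
    simp only [Set.mem_ofPred_eq] at hw hw'
    by_cases hB : (o i ≤ w ∧ w < o (i + 1)) ∧ (o j ≤ w ∧ w < o (j + 1))
    · exact hij (h.unique hi hj hB.1.1 hB.1.2 hB.2.1 hB.2.2)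
    · simp only [carryWire] at hw hw'
      split_ifs at hw hw' <;> omega)
  refine ⟨Φ, p₁.mono ?_ ((h.sum_le 2 0).trans (by omega)) le_rfl, fun x => ⟨?_, ?_⟩⟩
  · intro w hw
    simp only [Finset.mem_range, Set.mem_iUnion, Set.mem_ofPred_eq, exists_prop, carryWire] at hw ⊢
    obtain ⟨j, hj, hw⟩ := hw
    have := h.bounds hj
    have := h.le
    split_ifs at hw <;> omega
  · intro j hj w h₁ h₂
    rw [p₂ x j (Finset.mem_range.2 hj) w (.inr ⟨h₁, h₂⟩), (hF j hj).2.1 x w h₁ h₂]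
  · intro w hw
    by_cases hc : ∃ j < t, w = carryWire t d j
    · obtain ⟨j, hj, rfl⟩ := hc
      have := h.bounds hj
      rw [p₂ x j (Finset.mem_range.2 hj) _ (.inl rfl), (hF j hj).2.2 x _ (by omega)]
    · refine p₁.isLocal.1 x w fun h' => ?_
      simp only [Finset.mem_range, Set.mem_iUnion, Set.mem_ofPred_eq, exists_prop] at h'
      obtain ⟨j, hj, rfl | h'⟩ := h'
      · exact hc ⟨j, hj, rfl⟩
      · have := h.bounds hj
        omega

/-- A controlled increment of the wires `2 * t + 32, …, N - 1` in logarithmic depth, correct if the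
wires below hold `1`. -/
theorem incBlocks (h : BlockLayout t k N o) (hd : N ≤ d) :
    ∃ Z : Equiv.Perm (Bits ℕ),
      Realizes {w | w = d ∨ w < N} (121 * N) (308 * k + 2 * t + 257) Z ∧
      ∀ x, (∀ w < 2 * t + 32, x w = true) → Z x = incOn (x d) (2 * t + 32) N x := by
  have hN := h.le
  obtain ⟨X, x₁, x₂⟩ := notInterval 0 (2 * t)
  obtain ⟨Y, y₁, y₂⟩ := notInterval (2 * t + 32) N
  obtain ⟨C, c₁, c₂⟩ := carries h hd
  obtain ⟨R, r₁, r₂⟩ := reflectBlocks h hd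
  obtain ⟨F, f₁, f₂⟩ := complementBlocks h hd
  have x₁' := x₁.mono (T := {w | w = d ∨ w < N}) (by
    intro w hw; simp only [Set.mem_ofPred_eq] at hw ⊢; omega) le_rfl le_rfl
  have y₁' := y₁.mono (T := {w | w = d ∨ w < N}) (by
    intro w hw; simp only [Set.mem_ofPred_eq] at hw ⊢; omega) le_rfl le_rfl
  -- `X` clears the flag and carry wires, `C` computes the carries, and `R` followed by `F`
  -- increments the blocks that receive one. Then `C⁻¹`, between complementations `Y`, erases the
  -- carries, since the complemented result has the same ones.
  refine ⟨X * (Y * (C⁻¹ * (Y * (F * (R * (C * X)))))),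
    (x₁'.mul (y₁'.mul (c₁.inv.mul (y₁'.mul (f₁.mul (r₁.mul (c₁.mul x₁'))))))).mono subset_rfl
      (by omega) (by omega), fun x hx => ?_⟩
  simp only [Equiv.Perm.mul_apply]
  have hX : ∀ w, 2 * t ≤ w → X x w = x w := fun w hw => by
    rw [x₂]; dsimp only; rw [if_neg (by omega)]
  have hX' : ∀ w, w < 2 * t → X x w = false := fun w hw => by
    rw [x₂]; dsimp only; rw [if_pos (by omega), hx w (by omega)]; rfl
  have hall : ∀ w, allOn (X x) (2 * t + 32) w = allOn x (2 * t + 32) w := fun w =>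
    allOn_congr fun v h₁ _ => hX v (by omega)
  have hC := c₂ (X x) hX' fun w h₁ h₂ => by rw [hX w h₁, hx w h₂]
  rw [hX d (by omega)] at hC
  have hCo : ∀ w, 2 * t ≤ w → C (X x) w = x w := fun w hw => by
    rw [hC]; dsimp only; rw [if_neg (by omega), hX w hw]
  have hCc : ∀ j < t, C (X x) (carryWire t d j) = (x d && allOn x (2 * t + 32) (o j)) := by
    intro j hj
    rw [hC, carryWire]
    dsimp only
    split_ifs with h₁ h₂ h₂
    · omega
    · rw [hX d (by omega), h₁, h.zero]; simp [allOn, andBelow]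
    · rw [hall, Nat.add_sub_cancel_left]
    · omega
  have hR := r₂ (C (X x)) (fun j hj h₁ w h₂ h₃ => by
    rw [hCc j hj, Bool.and_eq_true, allOn_eq_true] at h₁
    rw [hCo w h₂]
    rcases lt_or_ge w (2 * t + 32) with h' | h'
    · exact hx w h'
    · exact h₁.2 w h' h₃)
  have hF := f₂ (R (C (X x)))
  have hFB : ∀ w, 2 * t + 32 ≤ w → w < N →
      F (R (C (X x))) w = incOn (x d) (2 * t + 32) N x w := by
    intro w h₁ h₂
    obtain ⟨j, hj, h₃, h₄⟩ := h.exists_block h₁ h₂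
    have hb := h.bounds hj
    have hcw : carryWire t d j < 2 * t + 32 ∨ N ≤ carryWire t d j := by
      rw [carryWire]; split_ifs <;> omega
    rw [hF.1 j hj w h₃ h₄, hR.1 j hj w h₃ h₄, hR.2 _ hcw, hCc j hj, hCo w (by omega), incOn,
      if_pos ⟨h₁, h₂⟩, allOn_append x hb.1 h₃,
      allOn_congr (x := C (X x)) (y := x) fun v h₅ _ => hCo v (by omega)]
    cases x w <;> cases x d <;> cases allOn x (2 * t + 32) (o j) <;> cases allOn x (o j) w <;> rfl
  set y : Bits ℕ := fun w => if w < 2 * t then false else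
    if 2 * t + 32 ≤ w ∧ w < N then !(incOn (x d) (2 * t + 32) N x w) else x w with hy
  have hyB : ∀ w, 2 * t + 32 ≤ w → w < N → y w = !(incOn (x d) (2 * t + 32) N x w) :=
    fun w h₁ h₂ => by simp only [hy]; rw [if_neg (by omega), if_pos ⟨h₁, h₂⟩]
  have hyf : ∀ w, w < 2 * t → y w = false := fun w hw => by simp only [hy]; rw [if_pos hw]
  have hyo : ∀ w, 2 * t ≤ w → (w < 2 * t + 32 ∨ N ≤ w) → y w = x w := fun w h₁ h₂ => by
    simp only [hy]; rw [if_neg (by omega), if_neg (by omega)]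
  have key : C⁻¹ (Y (F (R (C (X x))))) = y := by
    rw [Equiv.Perm.inv_eq_iff_eq, c₂ y hyf fun w h₁ h₂ => by rw [hyo w h₁ (.inl h₂), hx w h₂]]
    funext w
    rw [y₂]
    dsimp only
    by_cases hB : 2 * t + 32 ≤ w ∧ w < N
    · rw [if_pos hB, if_neg (by omega), hFB w hB.1 hB.2, hyB w hB.1 hB.2]
    · rw [if_neg hB, hF.2 w (by omega), hR.2 w (by omega), hC]
      dsimp only
      split_ifs with h'
      · have hle : o (w - t) ≤ N := h.last ▸ h.mono (by omega) le_rfl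
        rw [hyo d (by omega) (.inr hd), hall, allOn_not_incOn hle hyB]
      · rcases lt_or_ge w (2 * t) with h₁ | h₁
        · rw [hyf w h₁, hX' w h₁]
        · rw [hX w h₁, hyo w h₁ (by omega)]
  rw [key, x₂]
  funext w
  rw [y₂]
  dsimp only
  by_cases hB : 2 * t + 32 ≤ w ∧ w < N
  · rw [if_neg (by omega), if_pos hB, hyB w hB.1 hB.2, Bool.not_not]
  · rw [if_neg hB, incOn, if_neg hB]
    split_ifs with h'
    · rw [hyf w (by omega), hx w (by omega)]; rfl
    · rw [hyo w (by omega) (by omega)]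

end Realizes

/-! ### Control by the low wires and small cases -/

/-- Decrementing is incrementing between two complementations. This shows that an operation agreeing
with `incOn` on states whose low part is all ones maps those states onto themselves. -/
theorem incOn_surjective (c : Bool) (lo hi : ℕ) (y : Bits ℕ) :
    ∃ x, incOn c lo hi x = y ∧ ∀ w, w < lo ∨ hi ≤ w → x w = y w := by
  set z : Bits ℕ := fun w => !(y w) with hz
  set x : Bits ℕ := fun w => if lo ≤ w ∧ w < hi then !(incOn c lo hi z w) else y w with hx
  have hxB : ∀ w, lo ≤ w → w < hi → x w = !(incOn c lo hi z w) := fun w h₁ h₂ => by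
    simp only [hx]; rw [if_pos ⟨h₁, h₂⟩]
  have hxo : ∀ w, ¬(lo ≤ w ∧ w < hi) → x w = y w := fun w h => by
    simp only [hx]; rw [if_neg h]
  refine ⟨x, ?_, fun w hw => hxo w (by omega)⟩
  funext w
  by_cases hB : lo ≤ w ∧ w < hi
  · rw [incOn, if_pos hB, allOn_not_incOn hB.2.le hxB, hxB w hB.1 hB.2, incOn, if_pos hB]
    simp [hz]
  · rw [incOn, if_neg hB, hxo w hB]

/-- The high part must be treated first: its carry is the conjunction of the low bits before they
are incremented. -/
theorem incOn_append {a N : ℕ} (haN : a ≤ N) (x : Bits ℕ) :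
    incOn true 0 a (incOn (allOn x 0 a) a N x) = incOn true 0 N x := by
  funext w
  have hlow : ∀ v, v < a → incOn (allOn x 0 a) a N x v = x v := fun v hv => by
    rw [incOn, if_neg (by omega)]
  rcases lt_or_ge w a with h | h
  · rw [incOn, if_pos (by omega), hlow w h, allOn_congr (y := x) fun v _ hv => hlow v (by omega),
      incOn, if_pos (by omega)]
  · rw [incOn, if_neg (by omega), incOn, incOn]
    split_ifs with h₁ h₂ h₂
    · rw [allOn_append x (Nat.zero_le a) h, Bool.true_and]
    · omega
    · omega
    · rfl

namespace Realizes

/-- Flipping the wires `d` and `a, …, N - 1` if the wires `0, …, a - 1` all hold `1`. -/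
theorem controlledNot (k a N d : ℕ) (ha : 0 < a) (haN : 2 * a ≤ N) (hN : N ≤ 2 ^ k) (hd : N ≤ d) :
    ∃ M : Equiv.Perm (Bits ℕ),
      Realizes {w | w = d ∨ w < N} (8 * N) (4 * k + 2 + 4 * a) M ∧
      ∀ x, M x = fun w => if w = d ∨ (a ≤ w ∧ w < N) then xor (x w) (allOn x 0 a) else x w := by
  obtain ⟨m, rfl⟩ : ∃ m, a = m + 1 := ⟨a - 1, by omega⟩
  obtain ⟨F, f₁, f₂, f₃⟩ := fanOut k (N - (m + 1)) (by omega) d (fun i => m + 1 + i)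
    (fun i hi j hj h => by omega) (fun i hi => by omega)
  obtain ⟨G, g₁, g₂, g₃⟩ := multiControlled m (fun i => i)
    (fun i => if i = m then d else m + 1 + i) (fun i hi j hj h => h)
    (fun i hi j hj h => by split_ifs at h <;> omega)
    (fun i hi j hj => by split_ifs <;> omega)
  simp only [if_true] at g₂ g₃
  have f₁' := f₁.mono (T := {w | w = d ∨ w < N}) (by
    rintro w (h | ⟨i, hi, rfl⟩)
    · exact .inl h
    · exact .inr (by omega)) le_rfl le_rfl
  have g₁' := g₁.mono (T := {w | w = d ∨ w < N}) (by
    rintro w ⟨i, hi, h⟩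
    simp only [Set.mem_ofPred_eq]
    split_ifs at h <;> omega) le_rfl le_rfl
  -- The two fan-outs of `d` leave on the high wires only the change of `d` made by `G`, the
  -- conjunction of the low wires. Since `2 * a ≤ N`, the high wires suffice as borrowed wires for
  -- `G`.
  refine ⟨F * (G * F), (f₁'.mul (g₁'.mul f₁')).mono subset_rfl (by omega) (by omega),
    fun x => ?_⟩
  simp only [Equiv.Perm.mul_apply]
  have hFo : ∀ z w, ¬(m + 1 ≤ w ∧ w < N) → F z w = z w := fun z w hw =>
    f₃ z w fun i hi => by omega
  have hFB : ∀ z w, m + 1 ≤ w → w < N → F z w = xor (z w) (z d) := fun z w h₁ h₂ => by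
    obtain ⟨i, rfl⟩ := Nat.exists_eq_add_of_le h₁
    exact f₂ z i (by omega)
  have hA : andBelow (fun l => F x l) (m + 1) = allOn x 0 (m + 1) := by
    rw [allOn]
    refine andBelow_congr fun l hl => ?_
    rw [hFo x l (by omega), Nat.zero_add]
  have hGd : G (F x) d = xor (x d) (allOn x 0 (m + 1)) := by
    rw [g₂, hA, hFo x d (by omega)]
  funext w
  by_cases hB : m + 1 ≤ w ∧ w < N
  · rw [if_pos (.inr hB), hFB _ w hB.1 hB.2, hGd, g₃ _ w (by omega), hFB _ w hB.1 hB.2]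
    cases x w <;> cases x d <;> cases allOn x 0 (m + 1) <;> rfl
  · rw [hFo _ w hB]
    by_cases hw : w = d
    · subst hw; rw [if_pos (.inl rfl), hGd]
    · rw [if_neg (by tauto), g₃ _ w hw, hFo _ w hB]

variable {t k N d : ℕ} {o : ℕ → ℕ}

/-- The increment of all blocks, controlled by the wires below them. -/
theorem incHigh (h : BlockLayout t k N o) (htN : 2 * (2 * t + 32) ≤ N) (hk : N ≤ 2 ^ k)
    (hd : N ≤ d) :
    ∃ F : Equiv.Perm (Bits ℕ),
      Realizes {w | w = d ∨ w < N} (258 * N) (624 * k + 20 * t + 774) F ∧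
      ∀ x, F x = incOn (allOn x 0 (2 * t + 32)) (2 * t + 32) N x := by
  obtain ⟨Z, z₁, z₂⟩ := incBlocks h hd
  set a := 2 * t + 32 with ha
  obtain ⟨M, m₁, m₂⟩ := controlledNot k a N d (by omega) htN hk hd
  -- If the low part holds ones, the high part x becomes the complement of x + d, minus 1 - d,
  -- complemented again: this is x + 1, and `d` is flipped twice.
  refine ⟨M * (Z⁻¹ * (M * Z)), (m₁.mul (z₁.inv.mul (m₁.mul z₁))).mono subset_rfl
    (by omega) (by omega), fun x => ?_⟩
  simp only [Equiv.Perm.mul_apply]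
  have z₂' : ∀ x, allOn x 0 a = true → Z x = incOn (x d) a N x := fun x hx =>
    z₂ x fun w hw => allOn_eq_true.1 hx w (Nat.zero_le _) hw
  have hlow : ∀ c x, allOn (incOn c a N x) 0 a = allOn x 0 a := fun c x =>
    allOn_congr fun w _ hw => by rw [incOn, if_neg (by omega)]
  by_cases hx : allOn x 0 a = true
  · rw [hx, z₂' x hx]
    have hMy : ∀ y, allOn y 0 a = true →
        M y = fun w => if w = d ∨ (a ≤ w ∧ w < N) then !(y w) else y w := by
      intro y hy
      rw [m₂, hy]
      simp only [Bool.xor_true]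
    rw [hMy (incOn (x d) a N x) (by rw [hlow, hx])]
    set y : Bits ℕ := fun w => if w = d ∨ (a ≤ w ∧ w < N) then !(incOn true a N x w) else x w
      with hy
    have hyB : ∀ w, a ≤ w → w < N → y w = !(incOn true a N x w) := fun w h₁ h₂ => by
      simp only [hy]; rw [if_pos (.inr ⟨h₁, h₂⟩)]
    have hyo : ∀ w, w ≠ d → ¬(a ≤ w ∧ w < N) → y w = x w := fun w h₁ h₂ => by
      simp only [hy]; rw [if_neg (by tauto)]
    have hyd : y d = !(x d) := by
      simp only [hy, true_or, if_true]; rw [incOn, if_neg (by omega)]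
    have hya : allOn y 0 a = true := by
      rw [← hx]; exact allOn_congr fun w _ hw => hyo w (by omega) (by omega)
    have hcarry : ∀ w, w ≤ N → allOn y a w = allOn x a w := fun w hw => by
      simpa using allOn_not_incOn (c := true) hw hyB
    have key : Z⁻¹ (fun w => if w = d ∨ (a ≤ w ∧ w < N) then !(incOn (x d) a N x w)
        else incOn (x d) a N x w) = y := by
      rw [Equiv.Perm.inv_eq_iff_eq, z₂' y hya, hyd]
      funext w
      by_cases hB : a ≤ w ∧ w < N
      · rw [if_pos (.inr hB), incOn, if_pos hB, incOn, if_pos hB, hcarry w hB.2.le,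
          hyB w hB.1 hB.2, incOn, if_pos hB]
        cases x w <;> cases x d <;> cases allOn x a w <;> rfl
      · rw [incOn, if_neg hB, incOn, if_neg hB]
        by_cases hw : w = d
        · subst hw; rw [if_pos (.inl rfl), hyd]
        · rw [if_neg (by tauto), hyo w hw hB]
    rw [key, hMy y hya]
    funext w
    by_cases hB : a ≤ w ∧ w < N
    · rw [if_pos (.inr hB), hyB w hB.1 hB.2, Bool.not_not]
    · rw [incOn, if_neg hB]
      by_cases hw : w = d
      · subst hw; rw [if_pos (.inl rfl), hyd, Bool.not_not]
      · rw [if_neg (by tauto), hyo w hw hB]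
  · have hM : ∀ y, allOn y 0 a = false → M y = y := by
      intro y hy
      rw [m₂, hy]
      simp
    -- Outside its range of validity `Z` is unspecified, but it permutes the states with low part
    -- all ones, so by injectivity it cannot move another state among them.
    have hZx : allOn (Z x) 0 a = false := by
      by_contra hne
      rw [Bool.not_eq_false] at hne
      have hdx : ∃ x', Z x' = Z x ∧ allOn x' 0 a = true := by
        obtain ⟨x', h₁, h₂⟩ := incOn_surjective (Z x d) a N (Z x)
        have h₃ : allOn x' 0 a = true := by
          rw [← hne]; exact allOn_congr fun w _ hw => h₂ w (.inl hw)
        exact ⟨x', by rw [z₂' x' h₃, h₂ d (.inr hd), h₁], h₃⟩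
      obtain ⟨x', h₁, h₂⟩ := hdx
      rw [Z.injective h₁] at h₂
      exact hx h₂
    rw [Bool.not_eq_true] at hx
    rw [hM _ hZx, show Z⁻¹ (Z x) = x from Equiv.Perm.inv_eq_iff_eq.2 rfl, hM x hx, hx]
    funext w
    simp [incOn]

/-- A multiply controlled `X` gate borrowing a single wire. -/
theorem multiControlled_one_dirty (m : ℕ) : ∀ v d, m ≤ v → m ≤ d → v ≠ d →
    ∃ F : Equiv.Perm (Bits ℕ),
      Realizes {w | w < m ∨ w = v ∨ w = d} (3 * 2 ^ m - 2) (3 * 2 ^ m - 2) F ∧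
      ∀ x, F x = fun w => if w = v then xor (x w) (allOn x 0 m) else x w := by
  induction m with
  | zero =>
    intro v d _ _ hvd
    refine ⟨(Gate.X v).perm, (gate _ ?_).mono subset_rfl (by norm_num) (by norm_num), fun x => ?_⟩
    · intro w hw
      simp only [Gate.support, Finset.coe_singleton, Set.mem_singleton_iff] at hw
      exact .inr (.inl hw)
    · funext w
      by_cases hw : w = v <;> simp [Gate.act, hw, allOn, andBelow]
  | succ m ih =>
    intro v d hv hd hvd
    obtain ⟨F, f₁, f₂⟩ := ih d v (by omega) (by omega) hvd.symm
    have h₁ : d ≠ m := by omega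
    have h₂ : m ≠ v := by omega
    set γ : Gate ℕ := Gate.CCX d m v h₁ hvd.symm h₂ with hγ
    have hγ₁ : ∀ x, γ.perm x = fun w => if w = v then xor (x w) (x d && x m) else x w := by
      intro x
      funext w
      by_cases hw : w = v <;> simp [hγ, Gate.act, hw]
    have k₁ : Realizes {w | w < m + 1 ∨ w = v ∨ w = d} 1 1 γ.perm := gate _ (by
      intro w hw
      simp only [hγ, Gate.support, Finset.coe_insert, Finset.coe_singleton, Set.mem_insert_iff,
        Set.mem_singleton_iff] at hw
      simp only [Set.mem_ofPred_eq]
      omega)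
    have f₁' := f₁.mono (T := {w | w < m + 1 ∨ w = v ∨ w = d}) (by
      intro w hw
      simp only [Set.mem_ofPred_eq] at hw ⊢
      omega) le_rfl le_rfl
    have hpow : 1 ≤ 2 ^ m := Nat.one_le_two_pow
    -- Here `F` toggles `d` while borrowing `v`. The two firings of `γ` leave on `v` the change of
    -- `d` times bit `m`, and the second `F` restores `d`. The cost obeys T(m + 1) = 2 T(m) + 2 with
    -- T(0) = 1.
    refine ⟨F * (γ.perm * (F * γ.perm)), (f₁'.mul (k₁.mul (f₁'.mul k₁))).mono subset_rfl
      (by rw [pow_succ]; omega) (by rw [pow_succ]; omega), fun x => ?_⟩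
    simp only [Equiv.Perm.mul_apply]
    have e₁ := hγ₁ x
    have e₂ := f₂ (γ.perm x)
    have e₃ := hγ₁ (F (γ.perm x))
    have e₄ := f₂ (γ.perm (F (γ.perm x)))
    have a₁ : allOn (γ.perm x) 0 m = allOn x 0 m := allOn_congr fun w _ hw => by
      rw [e₁]; dsimp only; rw [if_neg (by omega)]
    have a₂ : allOn (γ.perm (F (γ.perm x))) 0 m = allOn x 0 m := allOn_congr fun w _ hw => by
      rw [e₃]; dsimp only; rw [if_neg (by omega), e₂]; dsimp only
      rw [if_neg (by omega), e₁]; dsimp only; rw [if_neg (by omega)]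
    have a₃ : allOn x 0 (m + 1) = (allOn x 0 m && x m) := by
      simp [allOn, andBelow]
    rw [e₄, a₂]
    funext w
    rw [e₃]
    dsimp only
    rw [e₂]
    dsimp only
    rw [a₁, e₁, a₃]
    dsimp only
    by_cases hw : w = v
    · subst hw
      rw [if_neg hvd, if_pos rfl, if_neg hvd, if_pos rfl, if_pos rfl, if_neg hvd.symm,
        if_neg h₁.symm, if_neg h₂, if_pos rfl]
      cases x w <;> cases x d <;> cases x m <;> cases allOn x 0 m <;> rfl
    · simp only [if_neg hw]
      by_cases hwd : w = d
      · subst hwd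
        rw [if_pos rfl, if_pos rfl]
        simp
      · rw [if_neg hwd, if_neg hwd]

/-- An increment circuit of unspecified size borrowing a single wire. -/
theorem increment_one_dirty (n : ℕ) : ∀ d, n ≤ d →
    ∃ F : Equiv.Perm (Bits ℕ),
      Realizes {w | w = d ∨ w < n} (3 * 2 ^ n) (3 * 2 ^ n) F ∧
      ∀ x, F x = incOn true 0 n x := by
  induction n with
  | zero =>
    intro d _
    refine ⟨1, .one _ _ _, fun x => ?_⟩
    funext w
    rw [incOn, if_neg (by omega)]
    rfl
  | succ n ih =>
    intro d hd
    obtain ⟨F, f₁, f₂⟩ := ih d (by omega)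
    obtain ⟨G, g₁, g₂⟩ := multiControlled_one_dirty n n d le_rfl (by omega) (by omega)
    have f₁' := f₁.mono (T := {w | w = d ∨ w < n + 1}) (by
      intro w hw; simp only [Set.mem_ofPred_eq] at hw ⊢; omega) le_rfl le_rfl
    have g₁' := g₁.mono (T := {w | w = d ∨ w < n + 1}) (by
      intro w hw; simp only [Set.mem_ofPred_eq] at hw ⊢; omega) le_rfl le_rfl
    -- The top bit receives its carry before the lower bits change.
    refine ⟨F * G, (f₁'.mul g₁').mono subset_rfl (by rw [pow_succ]; omega)
      (by rw [pow_succ]; omega), fun x => ?_⟩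
    rw [Equiv.Perm.mul_apply, f₂, ← incOn_append (Nat.le_succ n), g₂]
    congr 1
    funext w
    rw [incOn]
    by_cases hw : w = n
    · subst hw
      rw [if_pos rfl, if_pos (by omega)]
      simp [allOn, andBelow]
    · rw [if_neg hw, if_neg (by omega)]

end Realizes

/-! ### Block sizes and the recursion -/

/-- The offset of block `j` when the size of block `i` is `2 ^ (i / 8 + 3)`. -/
def blockOffset (j : ℕ) : ℕ := ∑ i ∈ Finset.range j, 2 ^ (i / 8 + 3)

theorem blockOffset_succ (j : ℕ) : blockOffset (j + 1) = blockOffset j + 2 ^ (j / 8 + 3) :=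
  Finset.sum_range_succ _ _

theorem blockOffset_mono : Monotone blockOffset :=
  monotone_nat_of_le_succ fun j => by rw [blockOffset_succ]; exact Nat.le_add_right _ _

/-- Eight consecutive blocks are each at least half as large as the block after them, so together
they offer four times its size: three for workspace, the rest absorbing small constants. -/
theorem blockOffset_add_eight (m : ℕ) :
    blockOffset m + 4 * 2 ^ ((m + 8) / 8 + 3) ≤ blockOffset (m + 8) := by
  have h : ∀ n, blockOffset m + n * 2 ^ (m / 8 + 3) ≤ blockOffset (m + n) := by
    intro n
    induction n with
    | zero => simp
    | succ n ih =>
      have : 2 ^ (m / 8 + 3) ≤ 2 ^ ((m + n) / 8 + 3) :=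
        Nat.pow_le_pow_right (by norm_num) (by omega)
      rw [← Nat.add_assoc, blockOffset_succ, Nat.succ_mul]
      omega
  have h8 := h 8
  have : 2 ^ ((m + 8) / 8 + 3) = 2 * 2 ^ (m / 8 + 3) := by
    rw [show (m + 8) / 8 + 3 = (m / 8 + 3) + 1 by omega, pow_succ, mul_comm]
  omega

theorem exists_blockLayout (k N : ℕ) (hN : 35 ≤ N) (hk : N ≤ 2 ^ k) :
    ∃ t o, BlockLayout t k N o ∧ t ≤ 8 * k := by
  -- The constant 34 is 32 plus the 2 by which 2t grows. With `t` minimal, the last block starts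
  -- below `N` and exceeds its nominal size by at most 2. The 32 spare wires cover the 3 * (8 + 2) +
  -- 1 wires needed by an early block.
  have hex : ∃ t, N ≤ blockOffset t + 2 * t + 34 := ⟨N, by omega⟩
  classical
  set t := Nat.find hex with ht
  have h₁ : N ≤ blockOffset t + 2 * t + 34 := Nat.find_spec hex
  have h₂ : ∀ j < t, blockOffset j + 2 * t + 32 < N := by
    intro j hj
    have := Nat.find_min hex (m := t - 1) (by omega)
    have := blockOffset_mono (show j ≤ t - 1 by omega)
    omega
  have ht0 : 0 < t := by
    by_contra h0
    obtain h0 : t = 0 := by omega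
    rw [h0] at h₁
    simp [blockOffset] at h₁
    omega
  set o : ℕ → ℕ := fun j => if j < t then 2 * t + 32 + blockOffset j else N with ho
  have o₁ : ∀ j < t, o j = 2 * t + 32 + blockOffset j := fun j hj => if_pos hj
  have o₂ : o t = N := if_neg (lt_irrefl t)
  have hlt : ∀ j < t, o j < o (j + 1) ∧ o (j + 1) ≤ o j + 2 ^ (j / 8 + 3) + 2 := by
    intro j hj
    have hpos : 0 < 2 ^ (j / 8 + 3) := by positivity
    rw [o₁ j hj]
    have hs := blockOffset_succ j
    rcases lt_or_ge (j + 1) t with h | h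
    · rw [o₁ _ h]
      omega
    · have hjt : j + 1 = t := by omega
      have := h₂ j hj
      rw [hjt] at hs ⊢
      rw [o₂]
      omega
  have hs8 : ∀ j, 8 ≤ 2 ^ (j / 8 + 3) := fun j => by
    rw [pow_add]; have : 0 < 2 ^ (j / 8) := by positivity
    omega
  refine ⟨t, o, ⟨?_, o₂, fun j hj => (hlt j hj).1, ?_, ?_, ?_⟩, ?_⟩
  · rw [o₁ 0 ht0]; simp [blockOffset]
  · intro j hj
    have := hlt j hj
    rw [o₁ j hj] at *
    have h8 := hs8 j
    rcases lt_or_ge j 8 with h | h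
    · have : j / 8 = 0 := by omega
      simp only [this] at *
      omega
    · obtain ⟨m, rfl⟩ := Nat.exists_eq_add_of_le' h
      have := blockOffset_add_eight m
      omega
  · intro i j hj hij
    have := hlt j hj
    rw [o₁ j hj, o₁ (i + 1) (by omega)] at *
    have h8 := hs8 j
    obtain ⟨m, rfl⟩ := Nat.exists_eq_add_of_le' (show 8 ≤ j by omega)
    have := blockOffset_add_eight m
    have := blockOffset_mono (show i + 1 ≤ m by omega)
    omega
  · intro j hj
    have hle : o (j + 1) ≤ N := by
      rcases lt_or_ge (j + 1) t with h | h
      · rw [o₁ _ h]; have := h₂ _ h; omega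
      · rw [show j + 1 = t by omega, o₂]
    have := o₁ j hj
    omega
  -- Otherwise block `t - 2` alone would have at least `2 ^ k ≥ N` wires.
  · by_contra hlt'
    have h₃ := h₂ (t - 1) (by omega)
    have h₄ := blockOffset_succ (t - 2)
    rcases Nat.eq_zero_or_pos k with rfl | hk0
    · simp at hk; omega
    rw [show t - 2 + 1 = t - 1 by omega] at h₄
    have : 2 ^ k ≤ 2 ^ ((t - 2) / 8 + 3) := Nat.pow_le_pow_right (by norm_num) (by omega)
    omega

/-- The low part has `2 * t + 32` wires with t at most 8 (log n + 1). For large n this is at most n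
/ 2, and its logarithm at most half that of n (each logarithm increased by 1), so the recursive call
takes at most half of either budget. -/
theorem exists_log_bound : ∃ n₀ : ℕ, ∀ n ≥ n₀, 35 ≤ n ∧
    ∀ a ≤ 16 * (Nat.log 2 n + 1) + 32, 2 * a ≤ n ∧ 2 * (Nat.log 2 a + 1) ≤ Nat.log 2 n + 1 := by
  have hq : ∀ q, 12 ≤ q → 32 * q + 48 < 2 ^ (q - 1) := by
    intro q hq
    induction q, hq using Nat.le_induction with
    | base => norm_num
    | succ q hq ih =>
      rw [show q + 1 - 1 = q - 1 + 1 by omega, pow_succ]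
      omega
  -- Then `(Nat.log 2 n + 1) / 2` is at least 12, the start of the induction in `hq`.
  refine ⟨2 ^ 23, fun n hn => ⟨by norm_num at hn; omega, fun a ha => ?_⟩⟩
  have hn0 : n ≠ 0 := by norm_num at hn; omega
  have hL : 23 ≤ Nat.log 2 n := (Nat.le_log_iff_pow_le (by norm_num) hn0).2 hn
  have hLn : 2 ^ Nat.log 2 n ≤ n := Nat.pow_log_le_self 2 hn0
  set L := Nat.log 2 n with hLdef
  have h₁ := hq ((L + 1) / 2) (by omega)
  have h₂ : a < 2 ^ ((L + 1) / 2 - 1) := by omega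
  constructor
  · have h₃ : 2 ^ ((L + 1) / 2 - 1 + 1) ≤ 2 ^ L := Nat.pow_le_pow_right (by norm_num) (by omega)
    rw [pow_succ] at h₃
    omega
  · have h₃ : Nat.log 2 a < (L + 1) / 2 - 1 := Nat.log_lt_of_lt_pow' (by omega) h₂
    omega

/-- The increment of `n` bits can be carried out with `O(n)` gates in depth `O(log n)`, borrowing a
single wire. -/
theorem exists_increment_circuit : ∃ C : ℕ, ∀ n d, n ≤ d → ∃ F : Equiv.Perm (Bits ℕ),
    Realizes {w | w = d ∨ w < n} (C * n) (C * (Nat.log 2 n + 1)) F ∧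
      ∀ x, F x = incOn true 0 n x := by
  obtain ⟨n₀, hn₀⟩ := exists_log_bound
  -- With t at most 8L, the depth of `incHigh` is at most 784L + 774, below 1600L; it must fit into
  -- half of `C * L`. The second bound covers the exponential circuits for n below `n₀`.
  obtain ⟨C, hC₁, hC₂⟩ : ∃ C, 3200 ≤ C ∧ 3 * 2 ^ n₀ ≤ C :=
    ⟨3200 + 3 * 2 ^ n₀, by omega, by omega⟩
  refine ⟨C, fun n => ?_⟩
  induction n using Nat.strong_induction_on with
  | _ n ih =>
    intro d hd
    rcases lt_or_ge n n₀ with h | h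
    · obtain ⟨F, f₁, f₂⟩ := Realizes.increment_one_dirty n d hd
      rcases Nat.eq_zero_or_pos n with rfl | hn
      · refine ⟨1, .one _ _ _, fun x => ?_⟩
        funext w
        rw [incOn, if_neg (by omega)]
        rfl
      have : 3 * 2 ^ n ≤ C := (Nat.mul_le_mul_left 3
        (Nat.pow_le_pow_right (by norm_num) h.le)).trans hC₂
      exact ⟨F, f₁.mono subset_rfl (this.trans (Nat.le_mul_of_pos_right C hn))
        (this.trans (Nat.le_mul_of_pos_right C (by omega))), f₂⟩
    · obtain ⟨h35, hlog⟩ := hn₀ n h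
      set L := Nat.log 2 n + 1 with hL
      have hnL : n ≤ 2 ^ L := (Nat.lt_pow_succ_log_self (by norm_num) n).le
      obtain ⟨t, o, hlay, ht⟩ := exists_blockLayout L n h35 hnL
      obtain ⟨hα₁, hα₂⟩ := hlog (2 * t + 32) (by omega)
      obtain ⟨F, f₁, f₂⟩ := Realizes.incHigh hlay hα₁ hnL hd
      obtain ⟨G, g₁, g₂⟩ := ih (2 * t + 32) (by omega) d (by omega)
      have g₁' := g₁.mono (T := {w | w = d ∨ w < n}) (by
        intro w hw; simp only [Set.mem_ofPred_eq] at hw ⊢; omega) le_rfl le_rfl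
      refine ⟨G * F, (g₁'.mul f₁).mono subset_rfl ?_ ?_, fun x => ?_⟩
      · have : C * (2 * (2 * t + 32)) ≤ C * n := Nat.mul_le_mul_left C hα₁
        have : 3200 * n ≤ C * n := Nat.mul_le_mul_right n hC₁
        rw [mul_left_comm] at *
        omega
      · have h₁ : C * (2 * (Nat.log 2 (2 * t + 32) + 1)) ≤ C * L := Nat.mul_le_mul_left C hα₂
        have h₂ : 3200 * L ≤ C * L := Nat.mul_le_mul_right L hC₁
        have h₃ : 1 ≤ L := Nat.le_add_left 1 _
        clear_value L
        linarith
      · rw [Equiv.Perm.mul_apply, g₂, f₂, incOn_append (by omega)]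

/-! ### Moving circuits to other wires -/

section Transfer

variable {W W' : Type} [DecidableEq W] [DecidableEq W']

/-- The image gate exists for every `γ`, an arbitrary one if `γ` leaves `S`, so that a total map of
gates can be chosen. -/
theorem Gate.exists_map (S : Set W) (e : W → W') (he : Set.InjOn e S) (γ : Gate W) :
    ∃ δ : Gate W', (γ.support : Set W) ⊆ S → δ.support = γ.support.image e ∧
      ∀ x : Bits W', ∀ w ∈ S, δ.act x (e w) = γ.act (fun v => x (e v)) w := by
  by_cases hγ : (γ.support : Set W) ⊆ S
  swap
  · cases γ with
    | X t => exact ⟨.X (e t), fun h => absurd h hγ⟩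
    | CX c t _ => exact ⟨.X (e t), fun h => absurd h hγ⟩
    | CCX a b t _ _ _ => exact ⟨.X (e t), fun h => absurd h hγ⟩
  cases γ with
  | X t =>
    have ht : t ∈ S := hγ (by simp [support])
    refine ⟨.X (e t), fun _ => ⟨by simp [support], fun x w hw => ?_⟩⟩
    by_cases h : w = t
    · subst h; simp [act]
    · simp [act, h, he.ne hw ht h]
  | CX c t hct =>
    have ht : t ∈ S := hγ (by simp [support])
    have hc : c ∈ S := hγ (by simp [support])
    refine ⟨.CX (e c) (e t) (he.ne hc ht hct),
      fun _ => ⟨by simp [support, Finset.image_insert], fun x w hw => ?_⟩⟩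
    by_cases h : w = t
    · subst h; simp [act]
    · simp [act, h, he.ne hw ht h]
  | CCX a b t hab hat hbt =>
    have ht : t ∈ S := hγ (by simp [support])
    have ha : a ∈ S := hγ (by simp [support])
    have hb : b ∈ S := hγ (by simp [support])
    refine ⟨.CCX (e a) (e b) (e t) (he.ne ha hb hab) (he.ne ha ht hat) (he.ne hb ht hbt),
      fun _ => ⟨by simp [support, Finset.image_insert], fun x w hw => ?_⟩⟩
    by_cases h : w = t
    · subst h; simp [act]
    · simp [act, h, he.ne hw ht h]

/-- A circuit can be moved to other wires. -/
theorem Realizes.map {S : Set W} {g d : ℕ} {f : Equiv.Perm (Bits W)} (h : Realizes S g d f)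
    (e : W → W') (he : Set.InjOn e S) :
    ∃ F, Realizes (e '' S) g d F ∧
      ∀ x : Bits W', ∀ w ∈ S, F x (e w) = f (fun v => x (e v)) w := by
  obtain ⟨Q, hQ, rfl, hg, hd⟩ := h
  choose m hm using Gate.exists_map S e he
  have hcirc : ∀ Q : Circuit W, (∀ γ ∈ Q.allGates, (γ.support : Set W) ⊆ S) →
      ∃ Q' : Circuit W', Q'.allGates = Q.allGates.map m ∧ Q'.depth = Q.depth := by
    intro Q
    induction Q with
    | nil => intro _; exact ⟨[], rfl, rfl⟩
    | cons l Q ih =>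
      intro hQ
      simp only [Circuit.allGates, List.flatMap_cons, List.mem_append] at hQ
      obtain ⟨Q', h₁, h₂⟩ := ih fun γ hγ => hQ γ (.inr hγ)
      refine ⟨⟨l.gates.map m, ?_⟩ :: Q', ?_, ?_⟩
      · rw [List.pairwise_map]
        refine l.disjoint.imp_of_mem fun {γ δ} hγ hδ hdis => ?_
        rw [(hm γ (hQ γ (.inl hγ))).1, (hm δ (hQ δ (.inl hδ))).1, Finset.disjoint_left]
        intro v hv hv'
        obtain ⟨a, ha, rfl⟩ := Finset.mem_image.1 hv
        obtain ⟨b, hb, hab⟩ := Finset.mem_image.1 hv'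
        obtain rfl := he (hQ δ (.inl hδ) hb) (hQ γ (.inl hγ) ha) hab
        exact Finset.disjoint_left.1 hdis ha hb
      · simp only [Circuit.allGates] at h₁
        simp [Circuit.allGates, h₁]
      · simpa [Circuit.depth] using h₂
  have hrun : ∀ L : List (Gate W), (∀ γ ∈ L, (γ.support : Set W) ⊆ S) → ∀ x : Bits W', ∀ w ∈ S,
      runGates (L.map m) x (e w) = runGates L (fun v => x (e v)) w := by
    intro L
    induction L with
    | nil => intro _ x w _; rfl
    | cons γ L ih =>
      intro hL x w hw
      have hL' : ∀ δ ∈ L, (δ.support : Set W) ⊆ S := fun δ hδ => hL δ (by simp [hδ])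
      simp only [List.map_cons, runGates, Equiv.Perm.mul_apply, Gate.perm_apply]
      rw [ih hL' _ w hw]
      exact (isLocal_runGates hL').2 _ _ (fun v hv => (hm γ (hL γ (by simp))).2 x v hv) w hw
  obtain ⟨Q', h₁, h₂⟩ := hcirc Q hQ
  refine ⟨runGates Q'.allGates, ⟨Q', ?_, rfl, ?_, h₂.trans_le hd⟩, ?_⟩
  · rw [h₁]
    intro δ hδ
    obtain ⟨γ, hγ, rfl⟩ := List.mem_map.1 hδ
    rw [(hm γ (hQ γ hγ)).1, Finset.coe_image]
    exact Set.image_mono (hQ γ hγ)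
  · rw [Circuit.gateCount, h₁, List.length_map]; exact hg
  · rw [h₁]; exact hrun _ hQ

end Transfer

/-! ### From operators to permutations of basis states -/

section Operators

variable {W : Type} [Fintype W] [DecidableEq W]

theorem basisOp_ext {U V : QState W →ₗ[ℂ] QState W} (h : ∀ x, U (ket x) = V (ket x)) : U = V := by
  refine LinearMap.pi_ext' fun x => LinearMap.ext_ring ?_
  have hk : ket x = Pi.single x (1 : ℂ) := by
    funext y
    rw [Pi.single_apply, ket]
    exact if_congr eq_comm rfl rfl
  simpa [hk] using h x

theorem basisOp_comp (f g : Bits W → Bits W) : basisOp f ∘ₗ basisOp g = basisOp (f ∘ g) :=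
  basisOp_ext fun x => by simp [basisOp_ket]

theorem basisOp_apply_injective {f : Bits W → Bits W} (hf : f.Injective) (φ : QState W)
    (x : Bits W) : basisOp f φ (f x) = φ x := by
  simp only [basisOp, LinearMap.coe_mk, AddHom.coe_mk]
  rw [Finset.sum_eq_single x]
  · simp
  · intro b _ hb
    simp [hf.ne hb]
  · simp

theorem ket_injective : Function.Injective (ket : Bits W → QState W) := by
  intro x y h
  by_contra hne
  have := congrFun h y
  simp [ket, hne] at this

theorem Circuit.op_eq (Q : Circuit W) : Q.op = basisOp (runGates Q.allGates) := by
  have : ∀ (L : List (Gate W)) (U : QState W →ₗ[ℂ] QState W),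
      L.foldl (fun U g => g.op ∘ₗ U) U = basisOp (runGates L) ∘ₗ U := by
    intro L
    induction L with
    | nil =>
      intro U
      have : basisOp (runGates ([] : List (Gate W))) = LinearMap.id :=
        basisOp_ext fun x => by rw [basisOp_ket]; rfl
      rw [this]; rfl
    | cons g L ih =>
      intro U
      rw [List.foldl_cons, ih, Gate.op, ← LinearMap.comp_assoc, basisOp_comp]
      rfl
  rw [Circuit.op, this, LinearMap.comp_id]

/-- Basis states suffice for testing. Conversely, both sides permute amplitudes: `u` is injective
because the circuit is, so the amplitude at an image is the amplitude at its preimage. -/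
theorem implementsDirty_iff {m a : ℕ} {Q : Circuit (Fin m ⊕ Fin a)}
    {u : Bits (Fin m) → Bits (Fin m)} :
    Q.ImplementsDirty (basisOp u) ↔
      ∀ x y, runGates Q.allGates (Sum.elim x y) = Sum.elim (u x) y := by
  have hket : ∀ (x : Bits (Fin m)) (y : Bits (Fin a)),
      tensorState (ket x) (ket y) = ket (Sum.elim x y) := by
    intro x y
    funext z
    have : Sum.elim x y = z ↔ x = (fun r => z (.inl r)) ∧ y = fun b => z (.inr b) := by
      constructor
      · rintro rfl; exact ⟨rfl, rfl⟩
      · rintro ⟨rfl, rfl⟩; funext w; cases w <;> rfl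
    simp only [tensorState, ket, this]
    split_ifs <;> simp_all
  constructor
  · intro h x y
    have := h (ket x) (ket y)
    rw [Circuit.op_eq, hket, basisOp_ket, basisOp_ket, hket] at this
    exact ket_injective this
  · intro h φ ψ
    have hu : u.Injective := by
      intro x x' hxx
      have : runGates Q.allGates (Sum.elim x fun _ => false) =
          runGates Q.allGates (Sum.elim x' fun _ => false) := by rw [h, h, hxx]
      have := (runGates Q.allGates).injective this
      funext i
      simpa using congrFun this (.inl i)
    rw [Circuit.op_eq]
    funext z
    obtain ⟨y, rfl⟩ := (runGates Q.allGates).surjective z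
    rw [basisOp_apply_injective (runGates Q.allGates).injective]
    have hy : y = Sum.elim (fun r => y (.inl r)) (fun b => y (.inr b)) := by
      funext w; cases w <;> rfl
    conv_rhs => rw [hy, h]
    simp only [tensorState, Sum.elim_inl, Sum.elim_inr]
    congr 1
    exact (basisOp_apply_injective hu φ _).symm

end Operators

/-! ### Binary increment and the operator identity -/

section Arithmetic

/-- The bits of `x`, followed by zeros. -/
def padBits {n : ℕ} (x : Bits (Fin n)) : ℕ → Bool := fun i => if h : i < n then x ⟨i, h⟩ else false

theorem padBits_val {n : ℕ} (x : Bits (Fin n)) (i : Fin n) : padBits x i = x i := by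
  simp [padBits]

theorem bitsVal_eq_ofBits {n : ℕ} (x : Bits (Fin n)) : bitsVal x = Nat.ofBits x := by
  induction n with
  | zero => simp [bitsVal]
  | succ n ih =>
    rw [Nat.ofBits_succ, ← ih, bitsVal, Fin.sum_univ_succ, bitsVal, Finset.mul_sum, add_comm]
    congr 1
    · refine Finset.sum_congr rfl fun i _ => ?_
      simp only [Function.comp, Fin.val_succ, pow_succ]
      ring
    · simp

theorem bitsVal_lt {n : ℕ} (x : Bits (Fin n)) : bitsVal x < 2 ^ n := by
  rw [bitsVal_eq_ofBits]; exact Nat.ofBits_lt_two_pow x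

theorem toBits_bitsVal {n : ℕ} (x : Bits (Fin n)) : toBits n (bitsVal x) = x := by
  funext i
  rw [toBits, bitsVal_eq_ofBits, Nat.testBit_ofBits_lt _ _ i.2]

theorem bitsVal_toBits {n v : ℕ} (hv : v < 2 ^ n) : bitsVal (toBits n v) = v := by
  rw [bitsVal_eq_ofBits]
  exact (Nat.ofBits_testBit v n).trans (Nat.mod_eq_of_lt hv)

theorem decBits_incBits {n : ℕ} (x : Bits (Fin n)) : decBits n (incBits n x) = x := by
  have h := bitsVal_lt x
  rw [decBits, incBits, bitsVal_toBits (Nat.mod_lt _ (by positivity)), Nat.mod_add_mod,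
    show bitsVal x + 1 + (2 ^ n - 1) = bitsVal x + 2 ^ n by omega, Nat.add_mod_right,
    Nat.mod_eq_of_lt h, toBits_bitsVal]

theorem incBits_decBits {n : ℕ} (x : Bits (Fin n)) : incBits n (decBits n x) = x := by
  have h := bitsVal_lt x
  rw [incBits, decBits, bitsVal_toBits (Nat.mod_lt _ (by positivity)), Nat.mod_add_mod,
    show bitsVal x + (2 ^ n - 1) + 1 = bitsVal x + 2 ^ n by omega, Nat.add_mod_right,
    Nat.mod_eq_of_lt h, toBits_bitsVal]

/-- Ripple-carry addition of 1; `andBelow z n` is the carry out of the first `n` bits. -/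
theorem sum_inc_bits (z : ℕ → Bool) (n : ℕ) :
    ∑ i ∈ Finset.range n, (xor (z i) (andBelow z i)).toNat * 2 ^ i +
      (andBelow z n).toNat * 2 ^ n = ∑ i ∈ Finset.range n, (z i).toNat * 2 ^ i + 1 := by
  induction n with
  | zero => simp [andBelow]
  | succ n ih =>
    rw [Finset.sum_range_succ, Finset.sum_range_succ, andBelow, pow_succ]
    cases h : andBelow z n <;> cases z n <;> simp [h] at ih ⊢ <;> omega

theorem incBits_apply {n : ℕ} (x : Bits (Fin n)) (i : Fin n) :
    incBits n x i = xor (x i) (andBelow (padBits x) i) := by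
  set y : Bits (Fin n) := fun i => xor (x i) (andBelow (padBits x) i) with hy
  have h₁ : bitsVal x = ∑ i ∈ Finset.range n, (padBits x i).toNat * 2 ^ i := by
    rw [Finset.sum_range, bitsVal]
    simp only [padBits_val]
  have h₂ : bitsVal y =
      ∑ i ∈ Finset.range n, (xor (padBits x i) (andBelow (padBits x) i)).toNat * 2 ^ i := by
    rw [Finset.sum_range, bitsVal]
    simp only [padBits_val, hy]
  have h₃ := sum_inc_bits (padBits x) n
  rw [← h₁, ← h₂] at h₃
  have h₄ : (bitsVal x + 1) % 2 ^ n = bitsVal y := by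
    rw [← h₃, Nat.add_mul_mod_self_right, Nat.mod_eq_of_lt (bitsVal_lt y)]
  rw [incBits, h₄, toBits_bitsVal]

theorem padBits_append_left {k n : ℕ} (x : Bits (Fin (k + n))) {i : ℕ} (hi : i ≤ k) :
    andBelow (padBits x) i = andBelow (padBits fun j => x (Fin.castAdd n j)) i := by
  refine andBelow_congr fun l hl => ?_
  rw [padBits, padBits, dif_pos (by omega), dif_pos (by omega)]
  rfl

theorem padBits_append_right {k n : ℕ} (x : Bits (Fin (k + n))) {i : ℕ} (hi : i ≤ n) :
    andBelow (padBits x) (k + i) = (andBelow (padBits fun j => x (Fin.castAdd n j)) k &&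
      andBelow (padBits fun j => x (Fin.natAdd k j)) i) := by
  rw [andBelow_add, padBits_append_left x le_rfl]
  congr 1
  refine andBelow_congr fun l hl => ?_
  rw [padBits, padBits, dif_pos (by omega), dif_pos (by omega)]
  rfl

theorem andBelow_padBits {k : ℕ} (x : Bits (Fin k)) :
    andBelow (padBits x) k = true ↔ ∀ i, x i = true := by
  rw [andBelow_eq_true]
  constructor
  · exact fun h i => by rw [← padBits_val x i]; exact h i i.2
  · exact fun h l hl => by rw [padBits, dif_pos hl]; exact h _

theorem controlledBits_incBits_apply_left {k n : ℕ} (x : Bits (Fin (k + n))) (i : Fin k) :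
    controlledBits k (incBits n) x (Fin.castAdd n i) = x (Fin.castAdd n i) := by
  rw [controlledBits]
  split_ifs
  · rw [Fin.append_left]
  · rfl

theorem controlledBits_incBits_apply_right {k n : ℕ} (x : Bits (Fin (k + n))) (j : Fin n) :
    controlledBits k (incBits n) x (Fin.natAdd k j) =
      xor (x (Fin.natAdd k j)) (andBelow (padBits x) (k + j)) := by
  rw [controlledBits, padBits_append_right x j.2.le]
  split_ifs with h
  · rw [Fin.append_right, incBits_apply, (andBelow_padBits _).2 h, Bool.true_and]
  · rw [← andBelow_padBits fun i => x (Fin.castAdd n i), Bool.not_eq_true] at h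
    rw [h]
    simp

theorem controlledBits_incBits (k n : ℕ) (x : Bits (Fin (k + n))) :
    controlledBits k (incBits n) x = onFirstBits n (decBits k) (incBits (k + n) x) := by
  have hfirst : (fun i => incBits (k + n) x (Fin.castAdd n i)) =
      incBits k fun i => x (Fin.castAdd n i) := by
    funext i
    rw [incBits_apply, incBits_apply]
    congr 1
    exact padBits_append_left x i.2.le
  funext i
  rw [onFirstBits, hfirst, decBits_incBits]
  refine Fin.addCases (fun i => ?_) (fun j => ?_) i
  · rw [controlledBits_incBits_apply_left, Fin.append_left]
  · rw [controlledBits_incBits_apply_right, Fin.append_right, incBits_apply]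
    rfl

end Arithmetic

/-- Increments of the first `m` of `N` qubits with a dirty ancilla. -/
theorem exists_increment_circuit_dirty : ∃ C : ℕ, ∀ m N, m ≤ N →
    ∃ F : Equiv.Perm (Bits (Fin N ⊕ Fin 1)),
      Realizes Set.univ (C * m) (C * (Nat.log 2 m + 1)) F ∧
      ∀ x y, F (Sum.elim x y) = Sum.elim
        (fun i : Fin N => xor (x i) (decide ((i : ℕ) < m) && andBelow (padBits x) i)) y := by
  obtain ⟨C, hC⟩ := exists_increment_circuit
  refine ⟨C, fun m N hmN => ?_⟩
  obtain ⟨F, f₁, f₂⟩ := hC m m le_rfl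
  -- The borrowed wire is placed at index `m` and becomes the ancilla; indices above `m` are
  -- irrelevant.
  set e : ℕ → Fin N ⊕ Fin 1 := fun w => if h : w < m then .inl ⟨w, by omega⟩ else .inr 0 with he
  have he₁ : ∀ w (h : w < m), e w = .inl ⟨w, by omega⟩ := fun w h => dif_pos h
  have he₂ : e m = .inr 0 := dif_neg (lt_irrefl m)
  obtain ⟨G, g₁, g₂⟩ := f₁.map e (by
    rintro a (rfl | ha) b (rfl | hb) hab
    · rfl
    · rw [he₂, he₁ b hb] at hab; cases hab
    · rw [he₂, he₁ a ha] at hab; cases hab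
    · rw [he₁ a ha, he₁ b hb] at hab; simpa using hab)
  refine ⟨G, g₁.mono (Set.subset_univ _) le_rfl le_rfl, fun x y => ?_⟩
  funext w
  rcases w with i | a
  · by_cases hi : (i : ℕ) < m
    · have hei : e i = .inl i := he₁ i hi
      rw [← hei, g₂ _ _ (.inr hi), f₂, incOn, if_pos (by omega), hei, Sum.elim_inl, Sum.elim_inl,
        Bool.true_and, allOn, Nat.sub_zero, decide_eq_true hi, Bool.true_and]
      congr 1
      refine andBelow_congr fun l hl => ?_
      rw [Nat.zero_add, he₁ l (by omega), Sum.elim_inl, padBits, dif_pos (by omega)]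
    · rw [g₁.isLocal.1 _ _, Sum.elim_inl, Sum.elim_inl, decide_eq_false hi]
      · simp
      · rintro ⟨w, rfl | hw, h⟩
        · rw [he₂] at h; cases h
        · rw [he₁ w hw] at h
          simp only [Sum.inl.injEq] at h
          subst h
          exact hi hw
  · obtain rfl : a = 0 := Subsingleton.elim _ _
    rw [← he₂, g₂ _ _ (.inl rfl), f₂, incOn, if_neg (by omega), he₂]
    rfl

/-! ### Lower bounds for gate count and depth -/

section LowerBounds

variable {W : Type} [DecidableEq W]

theorem Gate.card_support_le (γ : Gate W) : γ.support.card ≤ 3 := by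
  cases γ with
  | X t => simp [support]
  | CX c t _ => exact Finset.card_le_two.trans (by norm_num)
  | CCX a b t _ _ _ => exact Finset.card_le_three

/-- After a layer, each wire depends on at most three wires. -/
theorem Layer.exists_cone (l : Layer W) (v : W) : ∃ D : Finset W, D.card ≤ 3 ∧
    ∀ x y : Bits W, (∀ w ∈ D, x w = y w) → runGates l.gates x v = runGates l.gates y v := by
  by_cases h : ∃ γ ∈ l.gates, v ∈ γ.support
  · obtain ⟨γ, hγ, hv⟩ := h
    obtain ⟨L, M, hL⟩ := List.append_of_mem hγ
    have hd := l.disjoint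
    rw [hL, List.pairwise_append, List.pairwise_cons] at hd
    have h₁ : IsLocal ((γ.support : Set W)ᶜ) (runGates L) := isLocal_runGates fun δ hδ =>
      (Set.subset_compl_iff_disjoint_right).2 (Finset.disjoint_coe.2 (hd.2.2 δ hδ γ (by simp)))
    have h₂ : IsLocal ((γ.support : Set W)ᶜ) (runGates M) := isLocal_runGates fun δ hδ =>
      (Set.subset_compl_iff_disjoint_right).2 (Finset.disjoint_coe.2 (hd.2.1.1 δ hδ).symm)
    refine ⟨γ.support, γ.card_support_le, fun x y hxy => ?_⟩
    rw [hL, runGates_append, runGates]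
    simp only [Equiv.Perm.mul_apply]
    rw [h₂.1 _ v (by simpa using hv), h₂.1 _ v (by simpa using hv)]
    exact γ.isLocal.2 _ _ (fun w hw => by
      rw [h₁.1 _ w (by simpa using hw), h₁.1 _ w (by simpa using hw), hxy w (by simpa using hw)])
      v (by simpa using hv)
  · push Not at h
    have h₁ : IsLocal ({v}ᶜ : Set W) (runGates l.gates) := isLocal_runGates fun δ hδ => by
      simpa using h δ hδ
    refine ⟨{v}, by simp, fun x y hxy => ?_⟩
    rw [h₁.1 _ v (by simp), h₁.1 _ v (by simp), hxy v (by simp)]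

/-- Each output of a circuit depends on at most `3 ^ depth` inputs. -/
theorem Circuit.exists_cone (Q : Circuit W) (v : W) : ∃ D : Finset W, D.card ≤ 3 ^ Q.depth ∧
    ∀ x y : Bits W, (∀ w ∈ D, x w = y w) →
      runGates Q.allGates x v = runGates Q.allGates y v := by
  induction Q with
  | nil => exact ⟨{v}, by simp [Circuit.depth], fun x y hxy => hxy v (by simp)⟩
  | cons l Q ih =>
    obtain ⟨D, hD, hD'⟩ := ih
    choose c hc hc' using l.exists_cone
    -- Each of the wires read by the later layers depends on at most three wires before the first
    -- layer.
    refine ⟨D.biUnion c, ?_, fun x y hxy => ?_⟩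
    · refine (Finset.card_biUnion_le_card_mul D c 3 fun a _ => hc a).trans ?_
      rw [Circuit.depth, List.length_cons, pow_succ]
      exact Nat.mul_le_mul_right 3 hD
    · simp only [Circuit.allGates, List.flatMap_cons, runGates_append, Equiv.Perm.mul_apply]
      exact hD' _ _ fun w hw => hc' w x y fun u hu => hxy u (Finset.mem_biUnion.2 ⟨w, hw, hu⟩)

theorem card_le_of_forall_mem_support (L : List (Gate W)) (A : Finset W)
    (h : ∀ w ∈ A, ∃ γ ∈ L, w ∈ γ.support) : A.card ≤ 3 * L.length := by
  induction L generalizing A with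
  | nil =>
    have : A = ∅ := Finset.eq_empty_of_forall_notMem fun w hw => by simpa using h w hw
    simp [this]
  | cons γ L ih =>
    have h₁ := ih (A \ γ.support) fun w hw => by
      obtain ⟨δ, hδ, hw'⟩ := h w (Finset.mem_sdiff.1 hw).1
      rcases List.mem_cons.1 hδ with rfl | hδ
      · exact absurd hw' (Finset.mem_sdiff.1 hw).2
      · exact ⟨δ, hδ, hw'⟩
    have h₂ := Finset.card_le_card_sdiff_add_card (s := A) (t := γ.support)
    have h₃ := γ.card_support_le
    rw [List.length_cons]
    omega

variable {k n : ℕ} {Q : Circuit (Fin (k + n) ⊕ Fin 1)}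

theorem controlledBits_ones_apply (j : Fin n) :
    controlledBits k (incBits n) (fun _ => true) (Fin.natAdd k j) = false := by
  rw [controlledBits_incBits_apply_right]
  have : andBelow (padBits fun _ : Fin (k + n) => true) (k + j) = true :=
    andBelow_eq_true.2 fun l hl => by rw [padBits, dif_pos (by omega)]
  rw [this]
  rfl

/-- Every register wire is used by a circuit for the controlled increment. -/
theorem le_gateCount (hn : 0 < n) (hQ : Q.ImplementsDirty (controlledIncOp k n)) :
    k + n ≤ 3 * Q.gateCount := by
  rw [controlledIncOp, implementsDirty_iff] at hQ
  have huse : ∀ i : Fin (k + n), ∃ γ ∈ Q.allGates, Sum.inl i ∈ γ.support := by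
    intro i
    by_contra hi
    push Not at hi
    have hloc : IsLocal ({Sum.inl i}ᶜ : Set (Fin (k + n) ⊕ Fin 1)) (runGates Q.allGates) :=
      isLocal_runGates fun δ hδ => by simpa using hi δ hδ
    -- On the all-ones input every target bit changes to 0, so a target wire cannot be untouched.
    -- Clearing one control leaves the targets at 1, so an untouched control would be read by
    -- nobody, a contradiction.
    have hx := hQ (fun _ => true) (fun _ => true)
    revert hi hloc
    refine Fin.addCases (fun i => ?_) (fun j => ?_) i
    · intro _ hloc
      have hy := hQ (Function.update (fun _ => true) (Fin.castAdd n i) false) (fun _ => true)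
      have h₁ := hloc.2 (Sum.elim (fun _ => true) fun _ => true)
        (Sum.elim (Function.update (fun _ => true) (Fin.castAdd n i) false) fun _ => true) (by
          rintro (w | w) hw
          · have : w ≠ Fin.castAdd n i := by rintro rfl; exact hw rfl
            simp [this]
          · rfl) (.inl (Fin.natAdd k ⟨0, hn⟩)) (by
          simp [Fin.ext_iff]; omega)
      rw [hx, hy, Sum.elim_inl, Sum.elim_inl, controlledBits_ones_apply, controlledBits,
        if_neg fun h => by simpa using h i] at h₁
      rw [Function.update_of_ne (by simp [Fin.ext_iff]; omega)] at h₁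
      cases h₁
    · intro _ hloc
      have h₁ := hloc.1 (Sum.elim (fun _ => true) fun _ => true) (.inl (Fin.natAdd k j)) (by simp)
      rw [hx, Sum.elim_inl, Sum.elim_inl, controlledBits_ones_apply] at h₁
      cases h₁
  have := card_le_of_forall_mem_support Q.allGates
    (Finset.univ.map Function.Embedding.inl : Finset (Fin (k + n) ⊕ Fin 1)) (by
      intro w hw
      obtain ⟨i, -, rfl⟩ := Finset.mem_map.1 hw
      exact huse i)
  rw [Circuit.gateCount]
  simpa using this

/-- The most significant output bit of a controlled increment depends on all register wires. -/
theorem le_three_pow_depth (hn : 0 < n) (hQ : Q.ImplementsDirty (controlledIncOp k n)) :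
    k + n ≤ 3 ^ Q.depth := by
  rw [controlledIncOp, implementsDirty_iff] at hQ
  obtain ⟨m, rfl⟩ : ∃ m, n = m + 1 := ⟨n - 1, by omega⟩
  set top : Fin (k + (m + 1)) := Fin.natAdd k (Fin.last m) with htop
  obtain ⟨D, hD, hcone⟩ := Q.exists_cone (.inl top)
  have hmem : ∀ i, (Sum.inl i : Fin (k + (m + 1)) ⊕ Fin 1) ∈ D := by
    intro i
    by_contra hi
    -- Clearing any bit of the all-ones input changes the top output from 0 to 1: a lower bit stops
    -- the carry, and the top bit itself is toggled from 0.
    set y : Bits (Fin (k + (m + 1))) := Function.update (fun _ => true) i false with hy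
    have h₁ := hcone (Sum.elim (fun _ => true) fun _ => true) (Sum.elim y fun _ => true) (by
      rintro (w | w) hw
      · have : w ≠ i := by rintro rfl; exact hi hw
        simp [hy, this]
      · rfl)
    rw [hQ, hQ, Sum.elim_inl, Sum.elim_inl, htop, controlledBits_ones_apply,
      controlledBits_incBits_apply_right, ← htop] at h₁
    by_cases hit : i = top
    · have h₂ : andBelow (padBits y) (k + (Fin.last m : ℕ)) = true :=
        andBelow_eq_true.2 fun l hl => by
          rw [Fin.val_last] at hl
          rw [padBits, dif_pos (by omega), hy, Function.update_of_ne]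
          intro h
          rw [hit, htop, Fin.ext_iff] at h
          simp at h
          omega
      rw [h₂, hy, hit] at h₁
      simp at h₁
    · have h₂ : andBelow (padBits y) (k + (Fin.last m : ℕ)) = false := by
        rw [← Bool.not_eq_true, andBelow_eq_true]
        intro h
        have hlt : (i : ℕ) < k + (Fin.last m : ℕ) := by
          have h₃ : (i : ℕ) ≠ (top : ℕ) := fun h => hit (Fin.ext h)
          rw [htop, Fin.val_natAdd, Fin.val_last] at h₃
          rw [Fin.val_last]
          omega
        have := h i hlt
        rw [padBits_val] at this
        simp [hy] at this
      rw [h₂, hy, Function.update_of_ne (Ne.symm hit)] at h₁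
      simp at h₁
  refine le_trans ?_ hD
  have := Finset.card_le_card (s := Finset.univ.map Function.Embedding.inl) (t := D) (by
    intro w hw
    obtain ⟨i, -, rfl⟩ := Finset.mem_map.1 hw
    exact hmem i)
  simpa using this

end LowerBounds

/-! ### Assembly and constants -/

theorem controlledIncOp_eq (k n : ℕ) :
    controlledIncOp k n = decFirstOp k n ∘ₗ incOp (k + n) := by
  rw [controlledIncOp, decFirstOp, incOp, basisOp_comp]
  congr 1
  funext x
  exact controlledBits_incBits k n x

/-- Circuits of linear size and logarithmic depth for `INC` and for `DEC` on the first qubits. -/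
theorem exists_inc_dec_circuits : ∃ C : ℕ, ∀ k n : ℕ, 0 < n →
    ∃ Q₁ Q₂ : Circuit (Fin (k + n) ⊕ Fin 1),
      Q₁.ImplementsDirty (incOp (k + n)) ∧ Q₂.ImplementsDirty (decFirstOp k n) ∧
      Circuit.gateCount (Q₁ ++ Q₂) ≤ 2 * C * (k + n) ∧
      Circuit.depth (Q₁ ++ Q₂) ≤ 2 * C * (Nat.log 2 (k + n) + 1) := by
  obtain ⟨C, hC⟩ := exists_increment_circuit_dirty
  refine ⟨C, fun k n hn => ?_⟩
  obtain ⟨_, ⟨Q₁, -, rfl, g₁, d₁⟩, h₁⟩ := hC (k + n) (k + n) le_rfl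
  obtain ⟨F, f₁, f₂⟩ := hC k (k + n) (by omega)
  obtain ⟨Q₂, -, q₂, g₂, d₂⟩ := f₁.inv
  refine ⟨Q₁, Q₂, ?_, ?_, ?_, ?_⟩
  · rw [incOp, implementsDirty_iff]
    intro x y
    rw [h₁]
    congr 1
    funext i
    rw [incBits_apply, decide_eq_true i.2, Bool.true_and]
  · rw [decFirstOp, implementsDirty_iff]
    intro x y
    rw [q₂, Equiv.Perm.inv_eq_iff_eq, f₂]
    congr 1
    funext i
    rw [onFirstBits]
    set z := decBits k fun i => x (Fin.castAdd n i) with hz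
    have hinc : incBits k z = fun i => x (Fin.castAdd n i) := incBits_decBits _
    refine Fin.addCases (fun i => ?_) (fun j => ?_) i
    · have h₃ := incBits_apply z i
      rw [hinc] at h₃
      dsimp only at h₃
      rw [Fin.append_left, h₃, Fin.val_castAdd, decide_eq_true i.2, Bool.true_and,
        padBits_append_left _ i.2.le]
      simp only [Fin.append_left]
    · rw [Fin.append_right, Fin.val_natAdd, decide_eq_false (by omega)]
      simp
  · have : Circuit.gateCount (Q₁ ++ Q₂) = Q₁.gateCount + Q₂.gateCount := by
      simp [Circuit.gateCount, Circuit.allGates, List.flatMap_append]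
    have : C * k ≤ C * (k + n) := Nat.mul_le_mul_left C (by omega)
    rw [mul_assoc]
    omega
  · have : Circuit.depth (Q₁ ++ Q₂) = Q₁.depth + Q₂.depth := by
      simp [Circuit.depth]
    have : C * (Nat.log 2 k + 1) ≤ C * (Nat.log 2 (k + n) + 1) :=
      Nat.mul_le_mul_left C (Nat.add_le_add_right (Nat.log_mono_right (by omega)) 1)
    rw [mul_assoc]
    omega

theorem ImplementsDirty.append {m a : ℕ} {Q₁ Q₂ : Circuit (Fin m ⊕ Fin a)}
    {U V : QState (Fin m) →ₗ[ℂ] QState (Fin m)} (h₁ : Q₁.ImplementsDirty U)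
    (h₂ : Q₂.ImplementsDirty V) : Circuit.ImplementsDirty (Q₁ ++ Q₂) (V ∘ₗ U) := by
  intro φ ψ
  have h₃ := h₁ φ ψ
  have h₄ := h₂ (U φ) ψ
  rw [Circuit.op_eq] at *
  have : Circuit.allGates (Q₁ ++ Q₂) = Q₁.allGates ++ Q₂.allGates := List.flatMap_append
  rw [this, runGates_append, Equiv.Perm.coe_mul, ← basisOp_comp, LinearMap.comp_apply, h₃, h₄]
  rfl

/-- Here k + n ≤ kn + 1 ≤ (kn)², and log 2 > 1/2 turns the binary logarithm into at most 4 log(kn)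
and the summand 1 into at most 2 log(kn). -/
theorem natLog_le_log_mul {k n : ℕ} (h : 2 ≤ k * n) :
    ((Nat.log 2 (k + n) + 1 : ℕ) : ℝ) ≤ 6 * Real.log ((k : ℝ) * n) := by
  have hk : 0 < k := Nat.pos_of_ne_zero (by rintro rfl; simp at h)
  have hn : 0 < n := Nat.pos_of_ne_zero (by rintro rfl; simp at h)
  have h₁ : k + n ≤ (k * n) ^ 2 := by
    have : k + n ≤ k * n + 1 := by nlinarith
    nlinarith
  have h2 : (2 : ℝ) ≤ (k : ℝ) * n := by exact_mod_cast h
  have hlog : Real.log 2 ≤ Real.log ((k : ℝ) * n) := Real.log_le_log (by norm_num) h2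
  have hhalf : 1 / 2 < Real.log 2 := by linarith [Real.log_two_gt_d9]
  have hpow : ((2 : ℝ) ^ Nat.log 2 (k + n)) ≤ ((k : ℝ) * n) ^ 2 := by
    exact_mod_cast (Nat.pow_log_le_self 2 (by omega)).trans h₁
  have h₃ := Real.log_le_log (by positivity) hpow
  rw [Real.log_pow, Real.log_pow] at h₃
  push_cast at h₃ ⊢
  nlinarith [(Nat.cast_nonneg (Nat.log 2 (k + n)) : (0 : ℝ) ≤ _)]

/-- Both k and n are at most 3 ^ d, so log(kn) is at most 2d log 3, and log 3 ≤ 2. -/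
theorem log_mul_le_depth {k n d : ℕ} (h : 2 ≤ k * n) (hd : k + n ≤ 3 ^ d) :
    1 / 4 * Real.log ((k : ℝ) * n) ≤ d := by
  have h₁ : (k : ℝ) * n ≤ (3 ^ d) ^ 2 := by
    have : k * n ≤ (3 ^ d) ^ 2 := by nlinarith
    exact_mod_cast this
  have h2 : (2 : ℝ) ≤ (k : ℝ) * n := by exact_mod_cast h
  have h₃ := Real.log_le_log (by linarith) h₁
  rw [Real.log_pow, Real.log_pow] at h₃
  have h₄ := Real.log_le_sub_one_of_pos (show (0 : ℝ) < 3 by norm_num)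
  push_cast at h₃
  nlinarith [(Nat.cast_nonneg d : (0 : ℝ) ≤ d)]

/-- The first conjunct is the operator identity; the second gives circuits, split in the same way,
with the asserted cost; the third gives the matching lower bounds contained in `Θ`, for every
implementation with one dirty ancilla qubit. The condition `2 ≤ k * n` says that `k` and `n` are
positive and `Real.log (k * n) ≠ 0`. -/
theorem mainTheorem9 :
    (∀ k n : ℕ, controlledIncOp k n = decFirstOp k n ∘ₗ incOp (k + n)) ∧
    ∃ c C : ℝ, 0 < c ∧ 0 < C ∧ ∀ k n : ℕ, 2 ≤ k * n →
      (∃ Q₁ Q₂ : Circuit (Fin (k + n) ⊕ Fin 1),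
        Circuit.ImplementsDirty Q₁ (incOp (k + n)) ∧
        Circuit.ImplementsDirty Q₂ (decFirstOp k n) ∧
        Circuit.ImplementsDirty (Q₁ ++ Q₂) (controlledIncOp k n) ∧
        (Circuit.gateCount (Q₁ ++ Q₂) : ℝ) ≤ C * ((k : ℝ) + (n : ℝ)) ∧
        (Circuit.depth (Q₁ ++ Q₂) : ℝ) ≤ C * Real.log ((k : ℝ) * (n : ℝ))) ∧
      (∀ Q : Circuit (Fin (k + n) ⊕ Fin 1),
        Circuit.ImplementsDirty Q (controlledIncOp k n) →
        c * ((k : ℝ) + (n : ℝ)) ≤ (Circuit.gateCount Q : ℝ) ∧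
        c * Real.log ((k : ℝ) * (n : ℝ)) ≤ (Circuit.depth Q : ℝ)) := by
  obtain ⟨C, hC⟩ := exists_inc_dec_circuits
  -- The depth bound dictates 1/4, which is also below the 1/3 of the gate bound. The factor 12 is 2
  -- circuits times the 6 of `natLog_le_log_mul`; adding 1 ensures positivity.
  refine ⟨controlledIncOp_eq, 1 / 4, 12 * C + 1, by norm_num, by positivity, fun k n h => ?_⟩
  have hn : 0 < n := Nat.pos_of_ne_zero (by rintro rfl; simp at h)
  have hlog := natLog_le_log_mul h
  constructor
  · obtain ⟨Q₁, Q₂, h₁, h₂, hg, hd⟩ := hC k n hn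
    refine ⟨Q₁, Q₂, h₁, h₂, ?_, ?_, ?_⟩
    · rw [controlledIncOp_eq]
      exact ImplementsDirty.append h₁ h₂
    · have : (Circuit.gateCount (Q₁ ++ Q₂) : ℝ) ≤ 2 * C * ((k : ℝ) + n) := by exact_mod_cast hg
      refine this.trans (mul_le_mul_of_nonneg_right ?_ (by positivity))
      linarith [(Nat.cast_nonneg C : (0 : ℝ) ≤ C)]
    · have h₃ : (Circuit.depth (Q₁ ++ Q₂) : ℝ) ≤ 2 * C * ((Nat.log 2 (k + n) + 1 : ℕ) : ℝ) := by
        exact_mod_cast hd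
      have h₄ : 2 * (C : ℝ) * ((Nat.log 2 (k + n) + 1 : ℕ) : ℝ) ≤
          2 * C * (6 * Real.log ((k : ℝ) * n)) := mul_le_mul_of_nonneg_left hlog (by positivity)
      have h₅ : (0 : ℝ) ≤ ((Nat.log 2 (k + n) + 1 : ℕ) : ℝ) := Nat.cast_nonneg _
      linarith
  · intro Q hQ
    refine ⟨?_, log_mul_le_depth h (le_three_pow_depth hn hQ)⟩
    have : ((k : ℝ) + n) ≤ 3 * Circuit.gateCount Q := by exact_mod_cast le_gateCount hn hQ
    linarith [(Nat.cast_nonneg (Circuit.gateCount Q) : (0 : ℝ) ≤ _)]
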